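/- For partitions $\alpha,\beta$ of $d\ge 1$ and integers $g\ge 0$, $r\ge 1$ such that $rs=2g-2+l(\alpha)+l(\beta)$ for some integer $s\ge 0$ (where $l$ is the number of parts), the double Hurwitz number with completed $(r+1)$-cycles is $$H^{g,(r)}_{\alpha,\beta}=\frac{1}{\prod_i\alpha_i\prod_j\beta_j}\sum_{\lambda\vdash d}\chi^\lambda_\alpha\left(\frac{p_{r+1}(\lambda)}{(r+1)!}\right)^{s}\chi^\lambda_\beta ,\qquad p_k(\lambda)=\sum_{i\ge1}\left(\left(\lambda_i-i+\tfrac12\right)^k-\left(-i+\tfrac12\right)^k\right),$$ where $\chi^\lambda_\mu$ is the irreducible character of the symmetric group $S_d$ associated with $\lambda$ evaluated at permutations of cycle structure $\mu$. Let $g\ge 0$, let $n\ge 1$ be odd, and put $s=g+\frac{n-1}{2}$. Then there is a unique polynomial $P_{g,n}\in\mathbb{Q}[\beta_1,\dots,\beta_n]$ such that $$P_{g,n}(\beta_1,\dots,\beta_n)=\frac{d\,H^{g,(2)}_{(d),\beta}}{s!},\qquad d=\beta_1+\dots+\beta_n,$$ for all positive integers $\beta_1,\dots,\beta_n$, where $\beta$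 on the right is the partition of $d$ with parts $\beta_1,\dots,\beta_n$. For integers $b_1,\dots,b_n\ge 0$ with $b_1+\dots+b_n=g+\frac{n-1}{2}$, define the lowest-degree combinatorial Hodge integral by $$\langle\langle\tau_{b_1}\cdots\tau_{b_n}\Lambda_{2g}\rangle\rangle_g=(-1)^g\left[\beta_1^{b_1}\cdots\beta_n^{b_n}\right]P_{g,n}.$$ Then $$\langle\langle\tau_{b_1}\cdots\tau_{b_n}\Lambda_{2g}\rangle\rangle_g=\binom{g+\frac{n-1}{2}}{b_1,\dots,b_n}\,\mathbf{C}_{g,n},\qquad \mathbf{C}_{g,n}=\frac{(2g+n-1)!\,\left|2^{2g-1}-1\right|}{(2g)!\,\left(g+\frac{n-1}{2}\right)!\,2^{3g+\frac{n-3}{2}}}\,|B_{2g}|,$$ where $B_{2g}$ is the Bernoulli number ($B_0=1$, $B_2=\frac16$, $B_4=-\frac1{30},\dots$). -/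

import Mathlib

namespace CompletedCycles

open Finset

noncomputable section

/-! ### Partitions and Young diagrams -/

/-- The Young diagram of a partition `lam`, whose rows are the parts in weakly decreasing order. -/
def diagram {d : ℕ} (lam : d.Partition) : YoungDiagram :=
  YoungDiagram.ofRowLens (lam.parts.sort (· ≥ ·)) (lam.parts.pairwise_sort (· ≥ ·)).sortedGE

theorem card_cellsOfRowLens (w : List ℕ) : #(YoungDiagram.cellsOfRowLens w) = w.sum := by
  induction w with
  | nil => rfl
  | cons a w ih =>
    rw [YoungDiagram.cellsOfRowLens, card_union_of_disjoint, card_product, card_map, ih]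
    · simp
    · simp [disjoint_left]

theorem card_diagram {d : ℕ} (lam : d.Partition) : #(diagram lam).cells = d := by
  have h := card_cellsOfRowLens (lam.parts.sort (· ≥ ·))
  rw [← Multiset.sum_coe, Multiset.sort_eq, lam.parts_sum] at h
  exact h

/-- A Young tableau of shape `lam`: a numbering of the cells by `Fin d`. -/
abbrev Tableau {d : ℕ} (lam : d.Partition) : Type := (diagram lam).cells ≃ Fin d

/-- A fixed tableau of shape `lam`. -/
def tableau {d : ℕ} (lam : d.Partition) : Tableau lam :=
  equivFinOfCardEq (card_diagram lam)

/-! ### The irreducible representations and characters of the symmetric group -/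

/-- The permutations which map every row of the tableau to itself. -/
def rowStabilizer {d : ℕ} {lam : d.Partition} (T : Tableau lam) : Finset (Equiv.Perm (Fin d)) :=
  {σ | ∀ i, (T.symm (σ i)).1.1 = (T.symm i).1.1}

/-- The permutations which map every column of the tableau to itself. -/
def colStabilizer {d : ℕ} {lam : d.Partition} (T : Tableau lam) : Finset (Equiv.Perm (Fin d)) :=
  {σ | ∀ i, (T.symm (σ i)).1.2 = (T.symm i).1.2}

/-- The Young symmetrizer of a tableau in the group algebra `ℚ S_d`: the sum over the row
stabilizer times the signed sum over the column stabilizer. -/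
def youngSymmetrizer {d : ℕ} {lam : d.Partition} (T : Tableau lam) :
    MonoidAlgebra ℚ (Equiv.Perm (Fin d)) :=
  (∑ p ∈ rowStabilizer T, MonoidAlgebra.of ℚ _ p) *
    ∑ q ∈ colStabilizer T, ((Equiv.Perm.sign q : ℤ) : ℚ) • MonoidAlgebra.of ℚ _ q

/-- The Specht module: the left ideal of `ℚ S_d` generated by the Young symmetrizer. -/
abbrev spechtModule {d : ℕ} (lam : d.Partition) :
    Submodule (MonoidAlgebra ℚ (Equiv.Perm (Fin d))) (MonoidAlgebra ℚ (Equiv.Perm (Fin d))) :=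
  Submodule.span _ {youngSymmetrizer (tableau lam)}

/-- The irreducible representation of `S_d` associated with `lam`: the action of `S_d` by left
multiplication on the Specht module. -/
def spechtRep {d : ℕ} (lam : d.Partition) :
    Representation ℚ (Equiv.Perm (Fin d)) (spechtModule lam) :=
  ((Algebra.lsmul ℚ ℚ (spechtModule lam) :
    MonoidAlgebra ℚ (Equiv.Perm (Fin d)) →ₐ[ℚ] Module.End ℚ (spechtModule lam)) :
      MonoidAlgebra ℚ (Equiv.Perm (Fin d)) →* Module.End ℚ (spechtModule lam)).comp
    (MonoidAlgebra.of ℚ (Equiv.Perm (Fin d)))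

theorem exists_perm_of_partition {d : ℕ} (mu : d.Partition) :
    ∃ σ : Equiv.Perm (Fin d), σ.partition.parts = mu.parts := by
  have hsplit := Multiset.filter_add_not (fun k => 2 ≤ k) mu.parts
  have hone : mu.parts.filter (fun k => ¬ 2 ≤ k) =
      Multiset.replicate (Multiset.card (mu.parts.filter (fun k => ¬ 2 ≤ k))) 1 := by
    refine Multiset.eq_replicate_card.2 fun b hb => ?_
    have h1 := mu.parts_pos (Multiset.mem_of_mem_filter hb)
    have h2 := (Multiset.mem_filter.1 hb).2
    omega
  have hsum := congrArg Multiset.sum hsplit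
  rw [Multiset.sum_add, mu.parts_sum, hone, Multiset.sum_replicate, smul_eq_mul, mul_one] at hsum
  obtain ⟨σ, hσ⟩ := (Equiv.Perm.exists_with_cycleType_iff (Fin d)
    (m := mu.parts.filter (fun k => 2 ≤ k))).2
      ⟨by rw [Fintype.card_fin]; omega, fun a ha => (Multiset.mem_filter.1 ha).2⟩
  refine ⟨σ, ?_⟩
  rw [Equiv.Perm.parts_partition, ← Equiv.Perm.sum_cycleType, hσ, Fintype.card_fin]
  conv_rhs => rw [← hsplit, hone]
  congr 2
  omega

/-- The value `χ^lam_mu` of the irreducible character associated with `lam` at the permutations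
of cycle structure `mu`. -/
def chi {d : ℕ} (lam mu : d.Partition) : ℚ :=
  (spechtRep lam).character (exists_perm_of_partition mu).choose

/-! ### Double Hurwitz numbers with completed cycles -/

/-- The shifted symmetric power sum `p_k` at a partition. Row `i` of the diagram (counted from `0`)
has length `λ_{i+1}`; the terms beyond the last row vanish. -/
def shiftedPowerSum (k : ℕ) {d : ℕ} (lam : d.Partition) : ℚ :=
  ∑ i ∈ range (Multiset.card lam.parts),
    ((((diagram lam).rowLen i : ℚ) - (i + 1) + 1 / 2) ^ k - (-((i : ℚ) + 1) + 1 / 2) ^ k)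

/-- The disconnected double Hurwitz number `H^{g,(r)}_{α,β}` with completed `(r+1)`-cycles. It is
meant for `α`, `β` such that `r` divides `2g - 2 + l(α) + l(β)`; the quotient is `s`. -/
def hurwitz (g r : ℕ) {d : ℕ} (α β : d.Partition) : ℚ :=
  1 / ((α.parts.prod : ℚ) * (β.parts.prod : ℚ)) *
    ∑ lam : d.Partition,
      chi lam α *
        (shiftedPowerSum (r + 1) lam / ((r + 1).factorial : ℚ)) ^
          ((2 * g + Multiset.card α.parts + Multiset.card β.parts - 2) / r) *
        chi lam β

/-- The partition of `β_1 + … + β_n` with parts `β_1, …, β_n` (for positive `β_i`). -/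
def partitionOf {n : ℕ} (β : Fin n → ℕ) : (∑ i, β i).Partition :=
  Nat.Partition.ofSums _ (univ.val.map β) rfl

/-- The one-part double Hurwitz number `H^{g,(2)}_{(d),β}` with completed 3-cycles,
`d = β_1 + … + β_n`. -/
def onePartHurwitz (g : ℕ) {n : ℕ} (β : Fin n → ℕ) : ℚ :=
  hurwitz g 2 (Nat.Partition.indiscrete (∑ i, β i)) (partitionOf β)

/-! ### Combinatorial Hodge integrals -/

/-- `P` is a polynomial in `β_1, …, β_n` that agrees with `d H^{g,(2)}_{(d),β} / s!`,
`s = g + (n-1)/2`, at all positive integers `β_1, …, β_n`. -/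
def IsHurwitzPolynomial (g n : ℕ) (P : MvPolynomial (Fin n) ℚ) : Prop :=
  ∀ β : Fin n → ℕ, (∀ i, 0 < β i) →
    MvPolynomial.eval (fun i => (β i : ℚ)) P =
      ((∑ i, β i : ℕ) : ℚ) * onePartHurwitz g β / ((g + (n - 1) / 2).factorial : ℚ)

open Classical in
/-- The combinatorial Hodge integral `⟨⟨τ_{b_1} … τ_{b_n} Λ_{2k}⟩⟩_g`: `(-1)^k` times the
coefficient of `β_1^{b_1} … β_n^{b_n}` in the polynomial `d H^{g,(2)}_{(d),β} / s!`. It is meant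
for odd `n`, `k ≤ g` and `b_1 + … + b_n + 2k = 3g + (n-1)/2`. -/
def hodgeIntegral (g k : ℕ) {n : ℕ} (b : Fin n → ℕ) : ℚ :=
  if h : ∃ P : MvPolynomial (Fin n) ℚ, IsHurwitzPolynomial g n P then
    (-1) ^ k * MvPolynomial.coeff (Finsupp.equivFunOnFinite.symm b) h.choose
  else 0

/-- The constant `C_{g,n}`, for odd `n`. -/
def hodgeConstant (g n : ℕ) : ℚ :=
  ((2 * g + n - 1).factorial : ℚ) * |(2 : ℚ) ^ (2 * (g : ℤ) - 1) - 1| /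
      (((2 * g).factorial : ℚ) * ((g + (n - 1) / 2).factorial : ℚ) *
        (2 : ℚ) ^ (3 * (g : ℤ) + ((n : ℤ) - 3) / 2)) *
    |bernoulli (2 * g)|

end

end CompletedCycles

/-! A character `χ^λ` vanishes at a full cycle unless `λ` is a hook (`chi_indiscrete_eq_zero`). For
the hook with `k + 1` parts, `χ^λ_β` is `(-1)^k` times the coefficient of `X^k` in `Y = ∏ (1 -
X^{β_i}) / (1 - X)` (`chi_hook`), and `p_3 / 3! = d^3/24 + (d/2) x_k^2` with `x_k = (d-1)/2 - k`.
The signs of the two characters cancel, so the sum over partitions becomes `∑_k (d^3/24 + (d/2)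
x_k^2)^s Y_k`.

The moments `∑_k x_k^m Y_k` have exponential generating function `∏ 2 sinh(β_i z/2) / (2 sinh(z/2))
= ∏ β_i · z^{n-1} ∏ S(β_i z) / S(z)`, where `S(z) = 2 sinh(z/2) / z` (`sum_pow_mul_coeff`). The
factor `∏ β_i` cancels the prefactor of the Hurwitz number, and expanding the `s`-th power gives a
polynomial in `β`. It is unique because positive integer points are Zariski dense, so it is the one
chosen in `hodgeIntegral`.

The `j`-th binomial term contains `d^{3s-2j}`, so monomials of degree `s` come only from `j = s`.
There one reads off the multinomial coefficient from `d^s`, and `[z^{2g}] 1/S(z)`, a Bernoulli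
number, from the moment at `β = 0`.

The characters are computed from the Specht modules themselves. For a hook the Young symmetrizer `y`
satisfies `y^2 = m y`, so the character is `m⁻¹` times the trace of `x ↦ g x y` on the group
algebra. A Pieri relation links neighbouring hooks to a disjoint row and column, whose traces are
the coefficients of `det(1 + X g⁻¹)`. For a non-hook, the central sum of all full cycles kills the
symmetrizer of the `2 × 2` corner square, hence the whole Young symmetrizer. -/

namespace CompletedCycles

open Finset Equiv Equiv.Perm

/-! ### Row and column symmetrizers; the square of a hook symmetrizer. -/

section GroupAlgebra

variable {α : Type*} [Fintype α] [DecidableEq α]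

/-- The permutations which fix every point outside `X`. -/
def supportedOn (X : Finset α) : Finset (Perm α) := {σ | ∀ i, i ∉ X → σ i = i}

theorem mem_supportedOn {X : Finset α} {σ : Perm α} :
    σ ∈ supportedOn X ↔ ∀ i, i ∉ X → σ i = i := by
  simp [supportedOn]

theorem mul_mem_supportedOn {X : Finset α} {σ τ : Perm α} (hσ : σ ∈ supportedOn X)
    (hτ : τ ∈ supportedOn X) : σ * τ ∈ supportedOn X := by
  rw [mem_supportedOn] at *
  intro i hi
  rw [Perm.mul_apply, hτ i hi, hσ i hi]

theorem inv_mem_supportedOn {X : Finset α} {σ : Perm α} (hσ : σ ∈ supportedOn X) :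
    σ⁻¹ ∈ supportedOn X := by
  rw [mem_supportedOn] at *
  intro i hi
  rw [Perm.inv_eq_iff_eq, hσ i hi]

theorem swap_mem_supportedOn {X : Finset α} {i j : α} (hi : i ∈ X) (hj : j ∈ X) :
    swap i j ∈ supportedOn X := by
  rw [mem_supportedOn]
  intro l hl
  exact swap_apply_of_ne_of_ne (by rintro rfl; exact hl hi) (by rintro rfl; exact hl hj)

theorem supportedOn_mono {X Y : Finset α} (h : X ⊆ Y) : supportedOn X ⊆ supportedOn Y := by
  intro σ hσ
  rw [mem_supportedOn] at *
  exact fun i hi => hσ i fun h' => hi (h h')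

theorem apply_mem_of_mem_supportedOn {X : Finset α} {σ : Perm α} (hσ : σ ∈ supportedOn X) {i : α}
    (hi : i ∈ X) : σ i ∈ X := by
  by_contra h
  have := mem_supportedOn.1 hσ _ h
  exact h (by rwa [σ.injective this])

theorem card_supportedOn (X : Finset α) : #(supportedOn X) = (#X).factorial := by
  have h := Fintype.card_congr (Equiv.Perm.subtypeEquivSubtypePerm (fun i => i ∈ X))
  rw [Fintype.card_perm, Fintype.card_coe] at h
  rw [h, Fintype.card_subtype]
  rfl

theorem mul_comm_of_mem_supportedOn {X Y : Finset α} (h : Disjoint X Y) {σ τ : Perm α}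
    (hσ : σ ∈ supportedOn X) (hτ : τ ∈ supportedOn Y) : σ * τ = τ * σ := by
  refine Equiv.Perm.Disjoint.commute fun i => ?_
  by_cases hi : i ∈ X
  · exact Or.inr (mem_supportedOn.1 hτ i (disjoint_left.1 h hi))
  · exact Or.inl (mem_supportedOn.1 hσ i hi)

/-- The element `∑ ε(σ) σ` of the group algebra, with `σ` running over the permutations which fix
every point outside `X`. -/
noncomputable def symmetrizer (ε : Perm α →* ℤˣ) (X : Finset α) : MonoidAlgebra ℚ (Perm α) :=
  ∑ σ ∈ supportedOn X, ((ε σ : ℤ) : ℚ) • MonoidAlgebra.of ℚ _ σ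

/-- The sum of the transpositions `(o i)`, `i ∈ X`, weighted by `ε`; the term for `i = o` is the
identity. -/
noncomputable def starSum (ε : Perm α →* ℤˣ) (o : α) (X : Finset α) : MonoidAlgebra ℚ (Perm α) :=
  ∑ i ∈ X, ((ε (swap o i) : ℤ) : ℚ) • MonoidAlgebra.of ℚ _ (swap o i)

theorem unit_mul_self (u : ℤˣ) : ((u : ℤ) : ℚ) * ((u : ℤ) : ℚ) = 1 := by
  rcases Int.units_eq_one_or u with rfl | rfl <;> simp

theorem of_mul_symmetrizer (ε : Perm α →* ℤˣ) {X : Finset α} {σ : Perm α}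
    (hσ : σ ∈ supportedOn X) :
    MonoidAlgebra.of ℚ _ σ * symmetrizer ε X = ((ε σ : ℤ) : ℚ) • symmetrizer ε X := by
  rw [symmetrizer, mul_sum, smul_sum]
  refine sum_bij' (fun τ _ => σ * τ) (fun τ _ => σ⁻¹ * τ)
    (fun τ hτ => mul_mem_supportedOn hσ hτ)
    (fun τ hτ => mul_mem_supportedOn (inv_mem_supportedOn hσ) hτ) (by simp) (by simp) ?_
  intro τ _
  rw [mul_smul_comm, ← map_mul, smul_smul, map_mul ε, Units.val_mul, Int.cast_mul, ← mul_assoc,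
    unit_mul_self, one_mul]

theorem symmetrizer_mul_of (ε : Perm α →* ℤˣ) {X : Finset α} {σ : Perm α}
    (hσ : σ ∈ supportedOn X) :
    symmetrizer ε X * MonoidAlgebra.of ℚ _ σ = ((ε σ : ℤ) : ℚ) • symmetrizer ε X := by
  rw [symmetrizer, sum_mul, smul_sum]
  refine sum_bij' (fun τ _ => τ * σ) (fun τ _ => τ * σ⁻¹)
    (fun τ hτ => mul_mem_supportedOn hτ hσ)
    (fun τ hτ => mul_mem_supportedOn hτ (inv_mem_supportedOn hσ)) (by simp) (by simp) ?_
  intro τ _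
  rw [smul_mul_assoc, ← map_mul, smul_smul, map_mul ε, Units.val_mul, Int.cast_mul, mul_left_comm,
    unit_mul_self, mul_one]

theorem symmetrizer_mul_symmetrizer (ε : Perm α →* ℤˣ) {X Y : Finset α} (h : Y ⊆ X) :
    symmetrizer ε X * symmetrizer ε Y = ((#Y).factorial : ℚ) • symmetrizer ε X := by
  rw [symmetrizer.eq_1 ε Y, mul_sum, ← card_supportedOn, Nat.cast_smul_eq_nsmul, ← sum_const]
  refine sum_congr rfl fun σ hσ => ?_
  rw [mul_smul_comm, symmetrizer_mul_of ε (supportedOn_mono h hσ), smul_smul, unit_mul_self,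
    one_smul]

theorem of_mul_symmetrizer_comm (ε : Perm α →* ℤˣ) {X Y : Finset α} (h : Disjoint X Y)
    {σ : Perm α} (hσ : σ ∈ supportedOn X) :
    MonoidAlgebra.of ℚ _ σ * symmetrizer ε Y = symmetrizer ε Y * MonoidAlgebra.of ℚ _ σ := by
  rw [symmetrizer, sum_mul, mul_sum]
  refine sum_congr rfl fun τ hτ => ?_
  rw [mul_smul_comm, smul_mul_assoc, ← map_mul, ← map_mul, mul_comm_of_mem_supportedOn h hσ hτ]

theorem symmetrizer_mul_comm (ε ε' : Perm α →* ℤˣ) {X Y : Finset α} (h : Disjoint X Y) :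
    symmetrizer ε X * symmetrizer ε' Y = symmetrizer ε' Y * symmetrizer ε X := by
  rw [symmetrizer.eq_1 ε X, sum_mul, mul_sum]
  refine sum_congr rfl fun τ hτ => ?_
  rw [mul_smul_comm, smul_mul_assoc, of_mul_symmetrizer_comm ε' h hτ]

/-- Coset decomposition: `σ` factors uniquely as `τ (o i)` with `τ` fixing `o`, namely with `i = σ⁻¹
o`. -/
theorem symmetrizer_insert_right (ε : Perm α →* ℤˣ) {o : α} {X : Finset α} (ho : o ∉ X) :
    symmetrizer ε (insert o X) = symmetrizer ε X * starSum ε o (insert o X) := by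
  rw [symmetrizer, symmetrizer, starSum, sum_mul_sum, ← sum_product']
  refine sum_bij' (fun σ _ => (σ * swap o (σ⁻¹ o), σ⁻¹ o)) (fun p _ => p.1 * swap o p.2)
    ?_ ?_ (by simp [mul_assoc]) ?_ ?_
  · intro σ hσ
    have h1 := apply_mem_of_mem_supportedOn (inv_mem_supportedOn hσ) (mem_insert_self o X)
    rw [mem_product]
    refine ⟨?_, h1⟩
    have h2 := mul_mem_supportedOn hσ (swap_mem_supportedOn (mem_insert_self o X) h1)
    rw [mem_supportedOn] at h2 ⊢
    intro i hi
    by_cases hio : i = o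
    · subst hio; simp
    · exact h2 i (by simp [hi, hio])
  · rintro ⟨τ, i⟩ hp
    rw [mem_product] at hp
    exact mul_mem_supportedOn (supportedOn_mono (subset_insert _ _) hp.1)
      (swap_mem_supportedOn (mem_insert_self o X) hp.2)
  · rintro ⟨τ, i⟩ hp
    rw [mem_product] at hp
    have h1 : τ.symm o = o := by rw [symm_apply_eq, mem_supportedOn.1 hp.1 o ho]
    simp [h1, mul_assoc]
  · intro σ _
    rw [smul_mul_smul_comm, ← map_mul, ← Int.cast_mul, ← Units.val_mul, ← map_mul]
    simp [mul_assoc]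

theorem symmetrizer_insert_left (ε : Perm α →* ℤˣ) {o : α} {X : Finset α} (ho : o ∉ X) :
    symmetrizer ε (insert o X) = starSum ε o (insert o X) * symmetrizer ε X := by
  rw [symmetrizer, symmetrizer, starSum, sum_mul_sum, ← sum_product']
  refine sum_bij' (fun σ _ => (σ o, swap o (σ o) * σ)) (fun p _ => swap o p.1 * p.2)
    ?_ ?_ (by simp [← mul_assoc]) ?_ ?_
  · intro σ hσ
    have h1 := apply_mem_of_mem_supportedOn hσ (mem_insert_self o X)
    rw [mem_product]
    refine ⟨h1, ?_⟩
    have h2 := mul_mem_supportedOn (swap_mem_supportedOn (mem_insert_self o X) h1) hσ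
    rw [mem_supportedOn] at h2 ⊢
    intro i hi
    by_cases hio : i = o
    · subst hio; simp
    · exact h2 i (by simp [hi, hio])
  · rintro ⟨i, τ⟩ hp
    rw [mem_product] at hp
    exact mul_mem_supportedOn (swap_mem_supportedOn (mem_insert_self o X) hp.1)
      (supportedOn_mono (subset_insert _ _) hp.2)
  · rintro ⟨i, τ⟩ hp
    rw [mem_product] at hp
    have h1 : τ o = o := mem_supportedOn.1 hp.2 o ho
    simp [h1, ← mul_assoc]
  · intro σ _
    rw [smul_mul_smul_comm, ← map_mul, ← Int.cast_mul, ← Units.val_mul, ← map_mul]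
    simp [← mul_assoc]

omit [Fintype α] in
theorem starSum_insert (ε : Perm α →* ℤˣ) {o : α} {X : Finset α} (ho : o ∉ X) :
    starSum ε o (insert o X) = 1 + starSum ε o X := by
  rw [starSum, sum_insert ho, starSum, swap_self]
  simp [Equiv.Perm.one_def.symm, ← MonoidAlgebra.one_def]

/-- A permutation of `X` permutes the transpositions `(i l)`, `l ∈ X`. -/
theorem symmetrizer_mul_starSum_comm (ε : Perm α →* ℤˣ) {i : α} {X : Finset α} (hi : i ∉ X) :
    symmetrizer ε X * starSum 1 i X = starSum 1 i X * symmetrizer ε X := by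
  rw [symmetrizer, sum_mul, mul_sum]
  refine sum_congr rfl fun σ hσ => ?_
  rw [mul_smul_comm, smul_mul_assoc, starSum, mul_sum, sum_mul]
  congr 1
  refine sum_bij' (fun l _ => σ l) (fun l _ => σ⁻¹ l)
    (fun l hl => apply_mem_of_mem_supportedOn hσ hl)
    (fun l hl => apply_mem_of_mem_supportedOn (inv_mem_supportedOn hσ) hl) (by simp) (by simp) ?_
  intro l _
  have h : σ * swap i l = swap i (σ l) * σ := by
    rw [mul_swap_eq_swap_mul, mem_supportedOn.1 hσ i hi]
  simp only [MonoidHom.one_apply, Units.val_one, Int.cast_one, one_smul, ← map_mul, h]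

/-- The element `a_A b_B` of the group algebra, where `a_A` is the sum over the permutations
of `A` and `b_B` the signed sum over the permutations of `B`. -/
noncomputable def rowCol (A B : Finset α) : MonoidAlgebra ℚ (Perm α) :=
  symmetrizer 1 A * symmetrizer sign B

/-- The row sum absorbs `(i o)`, which moves past `(i j)` as `(o j)`, and the column sum turns that
into `-1`. The element therefore equals its own negative. -/
theorem symmetrizer_mul_swap_mul_symmetrizer_eq_zero {A B : Finset α} {o i j : α}
    (hoA : o ∈ A) (hiA : i ∈ A) (hoB : o ∈ B) (hjB : j ∈ B) (hio : i ≠ o) (hjo : j ≠ o) :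
    symmetrizer 1 A * MonoidAlgebra.of ℚ _ (swap i j) * symmetrizer sign B = 0 := by
  have h1 := symmetrizer_mul_of 1 (swap_mem_supportedOn hiA hoA)
  have h2 := of_mul_symmetrizer sign (swap_mem_supportedOn hoB hjB)
  rw [sign_swap hjo.symm] at h2
  simp only [MonoidHom.one_apply, Units.val_one, Int.cast_one, one_smul, Units.val_neg,
    Int.cast_neg, neg_smul] at h1 h2
  have h3 : swap i o * swap i j = swap i j * swap o j := by
    rw [mul_swap_eq_swap_mul (swap i j), swap_apply_of_ne_of_ne hio.symm hjo.symm,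
      swap_apply_right, swap_comm o i]
  have key : symmetrizer 1 A * MonoidAlgebra.of ℚ _ (swap i j) * symmetrizer sign B
      = -(symmetrizer 1 A * MonoidAlgebra.of ℚ _ (swap i j) * symmetrizer sign B) := by
    conv_lhs => rw [← h1, mul_assoc (symmetrizer 1 A), ← map_mul, h3, map_mul, ← mul_assoc,
      mul_assoc, h2, mul_neg]
  have h4 := add_eq_zero_iff_eq_neg.2 key
  rw [← two_smul ℚ] at h4
  exact (smul_eq_zero_iff_right two_ne_zero).1 h4

theorem starSum_sign_eq {o : α} {X : Finset α} (ho : o ∉ X) :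
    starSum sign o X = -starSum 1 o X := by
  rw [starSum, starSum, ← sum_neg_distrib]
  refine sum_congr rfl fun j hj => ?_
  rw [sign_swap (by rintro rfl; exact ho hj)]
  simp

/-- For a hook with arm `A` and leg `B`, sandwiching the transposition of the corner `o` and a cell
of the arm. -/
theorem rowCol_mul_swap_mul_symmetrizer {A B : Finset α} {o i : α} (hoB : o ∉ B) (hoA : o ∈ A)
    (hiA : i ∈ A) (hAB : Disjoint A B) (hio : i ≠ o) :
    rowCol A (insert o B) * MonoidAlgebra.of ℚ _ (swap o i) * symmetrizer sign (insert o B) =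
      ((#B).factorial : ℚ) • rowCol A (insert o B) := by
  have hiB : i ∉ B := disjoint_left.1 hAB hiA
  have hoi : Disjoint {o, i} B := by simp [hoB, hiB]
  have hi' : i ∉ insert o B := by simp [hio, hiB]
  -- Split the right factor as `b_B (1 - ∑ (o j))`. Here `b_B` commutes with `(o i)` and merges into
  -- the left factor, giving `|B|!`; then `(i o)(o j) = (o j)(i j)` and the left factor absorbs `(o
  -- j)` with a sign that cancels the minus.
  have h1 : symmetrizer sign (insert o B) * MonoidAlgebra.of ℚ _ (swap o i) *
      symmetrizer sign (insert o B) =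
      ((#B).factorial : ℚ) • (symmetrizer sign (insert o B) * starSum 1 i (insert o B)) := by
    nth_rewrite 2 [symmetrizer_insert_right sign hoB]
    rw [← mul_assoc, mul_assoc _ _ (symmetrizer sign B),
      of_mul_symmetrizer_comm sign hoi (swap_mem_supportedOn (by simp) (by simp)), ← mul_assoc,
      symmetrizer_mul_symmetrizer sign (subset_insert o B), smul_mul_assoc, smul_mul_assoc]
    congr 1
    rw [starSum_insert sign hoB, starSum_sign_eq hoB, starSum, starSum, sum_insert hoB, mul_add,
      mul_add, mul_one, mul_neg, mul_sum, mul_sum, swap_comm o i, ← sub_eq_add_neg,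
      sub_eq_add_neg, ← sum_neg_distrib]
    congr 1
    · simp
    · refine sum_congr rfl fun j hj => ?_
      have hjo : j ≠ o := by rintro rfl; exact hoB hj
      have hij : i ≠ j := by rintro rfl; exact hiB hj
      have h2 := symmetrizer_mul_of sign
        (swap_mem_supportedOn (mem_insert_self o B) (mem_insert_of_mem hj))
      rw [sign_swap hjo.symm] at h2
      have h3 : swap i o * swap o j = swap o j * swap i j := by
        rw [mul_swap_eq_swap_mul (swap o j), swap_apply_of_ne_of_ne hio hij, swap_apply_right,
          mul_swap_eq_swap_mul (swap i o), swap_apply_right,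
          swap_apply_of_ne_of_ne hij.symm hjo, mul_swap_eq_swap_mul (swap i j), swap_apply_left,
          swap_apply_of_ne_of_ne hio.symm hjo.symm, swap_comm j o]
      simp only [MonoidHom.one_apply, Units.val_one, Int.cast_one, one_smul]
      rw [mul_assoc, ← map_mul, h3, map_mul, ← mul_assoc, h2]
      simp
  -- Once the star sum at `i` stands between row and column sums, `(i o)` is absorbed by the row and
  -- every `(i j)` with `j ∈ B` gives zero.
  rw [rowCol, mul_assoc, mul_assoc, ← mul_assoc (symmetrizer sign _), h1,
    symmetrizer_mul_starSum_comm sign hi', mul_smul_comm, ← mul_assoc]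
  congr 1
  rw [starSum, sum_insert hoB, mul_add, add_mul]
  have h4 := symmetrizer_mul_of 1 (swap_mem_supportedOn hiA hoA)
  simp only [MonoidHom.one_apply, Units.val_one, Int.cast_one, one_smul] at h4 ⊢
  rw [h4, mul_sum, sum_mul, sum_eq_zero, add_zero]
  intro j hj
  exact symmetrizer_mul_swap_mul_symmetrizer_eq_zero hoA hiA (mem_insert_self o B)
    (mem_insert_of_mem hj) hio (by rintro rfl; exact hoB hj)

/-- The Young symmetrizer of a hook is a multiple of an idempotent. -/
theorem rowCol_mul_self {A B : Finset α} {o : α} (hoA : o ∉ A) (hoB : o ∉ B)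
    (hAB : Disjoint A B) :
    rowCol (insert o A) (insert o B) * rowCol (insert o A) (insert o B) =
      (((#A + #B + 1) * ((#B).factorial * (#A).factorial) : ℕ) : ℚ) •
        rowCol (insert o A) (insert o B) := by
  have hoAB : Disjoint A (insert o B) := by simp [hAB, hoA]
  have hB : symmetrizer sign (insert o B) * symmetrizer sign (insert o B) =
      (((#B + 1) * (#B).factorial : ℕ) : ℚ) • symmetrizer sign (insert o B) := by
    rw [symmetrizer_mul_symmetrizer sign subset_rfl, card_insert_of_notMem hoB,
      Nat.factorial_succ]
  have h1 : rowCol (insert o A) (insert o B) * starSum 1 o (insert o A) *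
      symmetrizer sign (insert o B) =
      (((#A + #B + 1) * (#B).factorial : ℕ) : ℚ) • rowCol (insert o A) (insert o B) := by
    rw [starSum_insert 1 hoA, mul_add, add_mul, mul_one, starSum, mul_sum, sum_mul]
    have h2 : ∀ i ∈ A, rowCol (insert o A) (insert o B) *
        ((((1 : Perm α →* ℤˣ) (swap o i) : ℤ) : ℚ) • MonoidAlgebra.of ℚ _ (swap o i)) *
        symmetrizer sign (insert o B) =
        ((#B).factorial : ℚ) • rowCol (insert o A) (insert o B) := by
      intro i hi
      simp only [MonoidHom.one_apply, Units.val_one, Int.cast_one, one_smul]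
      exact rowCol_mul_swap_mul_symmetrizer hoB (mem_insert_self o A) (mem_insert_of_mem hi)
        (by simp [hAB, hoB]) (by rintro rfl; exact hoA hi)
    rw [sum_congr rfl h2, sum_const, rowCol, mul_assoc, hB, mul_smul_comm,
      ← Nat.cast_smul_eq_nsmul ℚ, smul_smul, ← add_smul]
    congr 1
    push_cast
    ring
  have h3 : rowCol (insert o A) (insert o B) * symmetrizer 1 A =
      ((#A).factorial : ℚ) • rowCol (insert o A) (insert o B) := by
    rw [rowCol, mul_assoc, ← symmetrizer_mul_comm 1 sign hoAB, ← mul_assoc,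
      symmetrizer_mul_symmetrizer 1 (subset_insert o A), smul_mul_assoc]
  -- Write the second row sum as star sum times `a_A`; `a_A` commutes with the column sum because
  -- `A` avoids the column. The scalar that results is the product of the hook lengths.
  calc rowCol (insert o A) (insert o B) * rowCol (insert o A) (insert o B)
      = rowCol (insert o A) (insert o B) * starSum 1 o (insert o A) *
        symmetrizer sign (insert o B) * symmetrizer 1 A := by
        rw [rowCol.eq_1 (insert o A) (insert o B), mul_assoc _ (symmetrizer sign _)
          (symmetrizer 1 A), ← symmetrizer_mul_comm 1 sign hoAB]
        simp only [mul_assoc]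
        rw [← mul_assoc (starSum _ _ _), ← symmetrizer_insert_left 1 hoA]
    _ = _ := by
        rw [h1, smul_mul_assoc, h3, smul_smul]
        congr 1
        push_cast
        ring

end GroupAlgebra

end CompletedCycles

namespace CompletedCycles

open Finset Equiv Equiv.Perm

/-! ### The polynomial `det (1 + X σ)`: cycle type and principal minors. -/

section PermPoly

open Polynomial

variable {α : Type*} [Fintype α] [DecidableEq α]

/-- The matrix over `ℚ[X]` of a permutation. -/
noncomputable def polyPermMatrix (σ : Perm α) : Matrix α α ℚ[X] :=
  Matrix.of fun i j => if i = σ j then 1 else 0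

/-- The reversed characteristic polynomial `det (1 + X σ)` of a permutation. -/
noncomputable def permPoly (σ : Perm α) : ℚ[X] := (1 + (X : ℚ[X]) • polyPermMatrix σ).det

theorem polyPermMatrix_mul (σ τ : Perm α) :
    polyPermMatrix (σ * τ) = polyPermMatrix σ * polyPermMatrix τ := by
  ext1 i j
  rw [Matrix.mul_apply]
  simp only [polyPermMatrix, Matrix.of_apply, mul_ite, mul_one, mul_zero, sum_ite_eq', mem_univ,
    if_true]
  rfl

omit [Fintype α] in
-- In each column `j` one of the two permutations fixes `j` and the other agrees there with the
-- product.
theorem polyPermMatrix_add_of_disjoint {σ τ : Perm α} (h : Perm.Disjoint σ τ) :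
    polyPermMatrix σ + polyPermMatrix τ = 1 + polyPermMatrix (σ * τ) := by
  ext1 i j
  rw [Matrix.add_apply, Matrix.add_apply, Matrix.one_apply]
  change (if i = σ j then (1 : ℚ[X]) else 0) + (if i = τ j then 1 else 0) =
    (if i = j then 1 else 0) + (if i = σ (τ j) then 1 else 0)
  rcases h j with hj | hj
  · rcases h (τ j) with h' | h'
    · rw [hj, h']
    · have := τ.injective h'
      rw [this, hj]
  · rw [hj, add_comm]

/-- Since `σ + τ = 1 + στ` as matrices, `(1 + Xσ)(1 + Xτ) = (1 + X)(1 + Xστ)`. -/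
theorem permPoly_mul_of_disjoint {σ τ : Perm α} (h : Perm.Disjoint σ τ) :
    permPoly σ * permPoly τ = (1 + X) ^ Fintype.card α * permPoly (σ * τ) := by
  rw [permPoly, permPoly, permPoly, ← Matrix.det_mul, ← Matrix.det_smul]
  congr 1
  have h1 := polyPermMatrix_add_of_disjoint h
  rw [add_mul, mul_add, mul_add, one_mul, mul_one, one_mul, smul_mul_smul_comm,
    ← polyPermMatrix_mul, add_assoc, ← add_assoc (X • polyPermMatrix τ), ← smul_add,
    add_comm (polyPermMatrix τ), h1, smul_add, smul_add, smul_smul, add_smul, add_mul, add_smul,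
    one_smul, one_mul]
  abel

theorem permPoly_apply (σ : Perm α) :
    permPoly σ = ∑ τ : Perm α, ((sign τ : ℤ) : ℚ[X]) *
      ∏ i, ((if τ i = i then 1 else 0) + X * (if τ i = σ i then 1 else 0)) := by
  rw [permPoly, Matrix.det_apply']
  simp [polyPermMatrix, Matrix.one_apply]

/-- A permutation `τ` with `τ i ∈ {i, σ i}` for all `i`, where `σ` is a cycle, is `1` or `σ`. -/
theorem eq_one_or_eq_of_isCycle {σ τ : Perm α} (hσ : σ.IsCycle)
    (h : ∀ i, τ i = i ∨ τ i = σ i) : τ = 1 ∨ τ = σ := by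
  by_cases hex : ∃ i, σ i ≠ i ∧ τ i = i
  · left
    obtain ⟨i, hi, hτi⟩ := hex
    have hstep : ∀ j, τ (σ j) = σ j → τ j = j := by
      intro j hj
      rcases h j with h1 | h1
      · exact h1
      · have h2 := τ.injective (hj.trans h1.symm)
        rw [h1, h2]
    have hpow : ∀ (k : ℕ) j, (σ ^ k) j = i → τ j = j := by
      intro k
      induction k with
      | zero => intro j hj; simp only [pow_zero, Perm.one_apply] at hj; rw [hj, hτi]
      | succ k ih =>
        intro j hj
        rw [pow_succ, Perm.mul_apply] at hj
        exact hstep j (ih _ hj)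
    ext1 j
    by_cases hj : σ j = j
    · rcases h j with h1 | h1
      · simpa using h1
      · simpa [hj] using h1
    · obtain ⟨k, hk⟩ := (hσ.sameCycle hj hi).exists_nat_pow_eq
      simpa using hpow k j hk
  · right
    push Not at hex
    ext1 j
    by_cases hj : σ j = j
    · rcases h j with h1 | h1
      · rw [h1, hj]
      · exact h1
    · exact (h j).resolve_left (hex j hj)

/-- Only `1` and `σ` contribute to the Leibniz expansion, and the sign of a cycle of length `c` is
`-(-1)^c`. -/
theorem permPoly_of_isCycle {σ : Perm α} (hσ : σ.IsCycle) :
    permPoly σ = (1 - (-X) ^ #σ.support) * (1 + X) ^ (Fintype.card α - #σ.support) := by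
  have hne : (1 : Perm α) ≠ σ := hσ.ne_one.symm
  rw [permPoly_apply, ← sum_subset (subset_univ {1, σ}), sum_pair hne]
  · have h1 : (∏ i, ((if (1 : Perm α) i = i then (1 : ℚ[X]) else 0) +
        X * (if (1 : Perm α) i = σ i then 1 else 0))) =
        (1 + X) ^ (Fintype.card α - #σ.support) := by
      rw [← card_compl, ← prod_const, ← prod_subset (subset_univ σ.supportᶜ)]
      · refine prod_congr rfl fun i hi => ?_
        have : σ i = i := by simpa using hi
        simp [this]
      · intro i _ hi
        have : σ i ≠ i := by simpa using hi
        simp [this.symm]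
    have h2 : (∏ i, ((if σ i = i then (1 : ℚ[X]) else 0) +
        X * (if σ i = σ i then 1 else 0))) =
        X ^ #σ.support * (1 + X) ^ (Fintype.card α - #σ.support) := by
      rw [← card_compl, ← prod_const, ← prod_const, ← prod_mul_prod_compl σ.support]
      congr 1
      · refine prod_congr rfl fun i hi => ?_
        have : σ i ≠ i := by simpa using hi
        simp [this]
      · refine prod_congr rfl fun i hi => ?_
        have : σ i = i := by simpa using hi
        simp [this]
    rw [h1, h2, hσ.sign, neg_pow (X : ℚ[X])]
    simp
    ring
  · intro τ _ hτ
    have : ∃ i, ¬ (τ i = i ∨ τ i = σ i) := by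
      by_contra hcon
      push Not at hcon
      have := eq_one_or_eq_of_isCycle hσ hcon
      simp_all
    obtain ⟨i, hi⟩ := this
    push Not at hi
    rw [prod_eq_zero (mem_univ i), mul_zero]
    simp [hi.1, hi.2]

theorem permPoly_one : permPoly (1 : Perm α) = (1 + X) ^ Fintype.card α := by
  have h : polyPermMatrix (1 : Perm α) = 1 := by
    ext1 i j
    rw [Matrix.one_apply]
    rfl
  have h2 : (1 + (X : ℚ[X]) • (1 : Matrix α α ℚ[X])) = (1 + (X : ℚ[X])) • 1 := by
    rw [add_smul, one_smul]
  rw [permPoly, h, h2, Matrix.det_smul, Matrix.det_one, mul_one]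

theorem one_add_X_ne_zero : (1 + X : ℚ[X]) ≠ 0 := by
  intro h
  have := congrArg (eval 0) h
  simp at this

theorem permPoly_eq_cycleType (σ : Perm α) :
    permPoly σ = (σ.cycleType.map fun c => 1 - (-X : ℚ[X]) ^ c).prod *
      (1 + X) ^ (Fintype.card α - #σ.support) := by
  induction σ using cycle_induction_on with
  | base_one => simp [permPoly_one]
  | base_cycles σ hσ => rw [permPoly_of_isCycle hσ, hσ.cycleType]; simp
  | induction_disjoint σ τ h _ h1 h2 =>
    have h3 := permPoly_mul_of_disjoint h
    refine mul_left_cancel₀ (pow_ne_zero (Fintype.card α) one_add_X_ne_zero) ?_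
    rw [← h3, h1, h2, h.cycleType_mul, Multiset.map_add, Multiset.prod_add, h.card_support_mul]
    have h4 : #σ.support + #τ.support ≤ Fintype.card α := by
      rw [← h.card_support_mul]; exact card_le_univ _
    have h5 : (1 + X : ℚ[X]) ^ (Fintype.card α - #σ.support) *
        (1 + X) ^ (Fintype.card α - #τ.support) = (1 + X) ^ Fintype.card α *
          (1 + X) ^ (Fintype.card α - (#σ.support + #τ.support)) := by
      rw [← pow_add, ← pow_add]
      congr 1
      omega
    linear_combination (Multiset.map (fun c => 1 - (-X : ℚ[X]) ^ c) σ.cycleType).prod *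
      (Multiset.map (fun c => 1 - (-X : ℚ[X]) ^ c) τ.cycleType).prod * h5

theorem permPoly_eq (σ : Perm α) :
    permPoly σ = (σ.partition.parts.map fun c => 1 - (-X : ℚ[X]) ^ c).prod := by
  rw [permPoly_eq_cycleType, parts_partition, Multiset.map_add, Multiset.prod_add]
  simp

/-- A factorization `σ = p τ`, with `τ` supported on `S` and `p` off `S`, exists for a given `τ`
exactly when `τ` agrees with `σ` on `S`. The coefficient is thus the principal minor on `S` of the
matrix of `σ`. -/
theorem coeff_rowCol_compl (S : Finset α) (σ : Perm α) :
    (rowCol Sᶜ S).coeff σ = ∑ τ ∈ supportedOn S, ((sign τ : ℤ) : ℚ) *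
      ∏ i ∈ S, if τ i = σ i then 1 else 0 := by
  rw [rowCol, symmetrizer, symmetrizer, sum_mul_sum, sum_comm]
  simp only [MonoidHom.one_apply, Units.val_one, Int.cast_one, one_smul, mul_smul_comm,
    MonoidAlgebra.coeff_sum, Finsupp.finsetSum_apply, MonoidAlgebra.coeff_smul_apply,
    MonoidAlgebra.of_apply, MonoidAlgebra.single_mul_single, mul_one, MonoidAlgebra.coeff_single]
  refine sum_congr rfl fun τ hτ => ?_
  rw [← smul_sum, smul_eq_mul]
  congr 1
  have h1 : ∀ p : Perm α, (Finsupp.single (p * τ) (1 : ℚ)) σ = if p = σ * τ⁻¹ then 1 else 0 := by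
    intro p
    rw [Finsupp.single_apply]
    simp only [eq_mul_inv_iff_mul_eq]
  have h2 : σ * τ⁻¹ ∈ supportedOn Sᶜ ↔ ∀ i ∈ S, τ i = σ i := by
    rw [mem_supportedOn]
    constructor
    · intro h i hi
      have h2 := h (τ i) (by simpa using apply_mem_of_mem_supportedOn hτ hi)
      simpa using h2.symm
    · intro h i hi
      have hi' : i ∈ S := by simpa using hi
      have h2 := h (τ⁻¹ i) (apply_mem_of_mem_supportedOn (inv_mem_supportedOn hτ) hi')
      simpa using h2.symm
  simp only [h1]
  rw [sum_ite_eq', prod_ite_zero, prod_const_one]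
  by_cases h : ∀ i ∈ S, τ i = σ i
  · rw [if_pos (h2.2 h), if_pos h]
  · rw [if_neg (mt h2.1 h), if_neg h]

/-- The coefficient of `X^k` in `det (1 + X σ)` is the sum of the principal `k × k` minors; `S`
records the rows where the factor with `X` is taken. -/
theorem coeff_permPoly (σ : Perm α) (k : ℕ) :
    (permPoly σ).coeff k = ∑ S ∈ univ.powersetCard k, (rowCol Sᶜ S).coeff σ := by
  have h : permPoly σ = ∑ S : Finset α, C ((rowCol Sᶜ S).coeff σ) * X ^ #S := by
    rw [permPoly_apply]
    simp only [add_comm (ite _ (1 : ℚ[X]) 0), prod_add, mul_sum]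
    rw [sum_comm, powerset_univ]
    refine sum_congr rfl fun S _ => ?_
    rw [coeff_rowCol_compl, map_sum, sum_mul, ← sum_subset (subset_univ (supportedOn S))]
    · refine sum_congr rfl fun τ hτ => ?_
      rw [prod_mul_distrib, prod_const, prod_eq_one (s := univ \ S), mul_one, map_mul, map_prod]
      · simp only [apply_ite C, map_one, map_zero, map_intCast]
        ring
      · intro i hi
        rw [if_pos]
        exact mem_supportedOn.1 hτ i (by simpa using hi)
    · intro τ _ hτ
      rw [mem_supportedOn] at hτ
      push Not at hτ
      obtain ⟨i, hi, hτi⟩ := hτ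
      rw [prod_eq_zero (s := univ \ S) (i := i) (by simpa using hi) (by simp [hτi]), mul_zero,
        mul_zero]
  rw [h, finsetSum_coeff, ← powerset_univ]
  simp only [coeff_C_mul, coeff_X_pow, mul_ite, mul_one, mul_zero]
  rw [← sum_filter]
  refine sum_congr ?_ fun _ _ => rfl
  ext S
  simp [mem_powersetCard, eq_comm]

end PermPoly

end CompletedCycles

namespace CompletedCycles

open Finset Equiv Equiv.Perm

/-! ### Traces of hook symmetrizers on the group algebra. -/

section ConjTrace

variable {α : Type*} [Fintype α] [DecidableEq α]

/-- The trace of `y ↦ g y x` on the group algebra, as a function of `x`. -/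
noncomputable def conjTrace (g : Perm α) : MonoidAlgebra ℚ (Perm α) →ₗ[ℚ] ℚ :=
  LinearMap.trace ℚ _ ∘ₗ
    LinearMap.mulLeft ℚ (LinearMap.mulLeft ℚ (MonoidAlgebra.of ℚ (Perm α) g)) ∘ₗ
      (LinearMap.mul ℚ _).flip

omit [Fintype α] [DecidableEq α] in
theorem conjTrace_apply (g : Perm α) (x : MonoidAlgebra ℚ (Perm α)) :
    conjTrace g x = LinearMap.trace ℚ _
      (LinearMap.mulLeft ℚ (MonoidAlgebra.of ℚ (Perm α) g) * LinearMap.mulRight ℚ x) := rfl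

omit [Fintype α] [DecidableEq α] in
-- Right multiplications commute with left multiplication by `g`, and the trace is cyclic.
theorem conjTrace_mul_comm (g : Perm α) (x y : MonoidAlgebra ℚ (Perm α)) :
    conjTrace g (x * y) = conjTrace g (y * x) := by
  have h : ∀ u v : MonoidAlgebra ℚ (Perm α),
      LinearMap.mulRight ℚ (u * v) = LinearMap.mulRight ℚ v * LinearMap.mulRight ℚ u := by
    intro u v
    exact LinearMap.mulRight_mul ..
  rw [conjTrace_apply, conjTrace_apply, h, h, ← mul_assoc, LinearMap.trace_mul_comm, ← mul_assoc,
    ← mul_assoc, (LinearMap.commute_mulLeft_right (MonoidAlgebra.of ℚ (Perm α) g) x).eq]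

theorem conjTrace_eq_sum (g : Perm α) (x : MonoidAlgebra ℚ (Perm α)) :
    conjTrace g x = ∑ h : Perm α, x.coeff (h⁻¹ * g⁻¹ * h) := by
  rw [conjTrace_apply, LinearMap.trace_eq_matrix_trace ℚ (MonoidAlgebra.basis (Perm α) ℚ),
    Matrix.trace]
  refine sum_congr rfl fun h _ => ?_
  rw [Matrix.diag_apply, LinearMap.toMatrix_apply]
  change (MonoidAlgebra.of ℚ (Perm α) g * (MonoidAlgebra.basis (Perm α) ℚ h * x)).coeff h = _
  rw [MonoidAlgebra.basis_apply, MonoidAlgebra.of_apply, MonoidAlgebra.coeff_single_mul_apply,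
    MonoidAlgebra.coeff_single_mul_apply, one_mul, one_mul, mul_assoc]

theorem of_mul_symmetrizer_mul_of_inv (ε : Perm α →* ℤˣ) (X : Finset α) (h : Perm α) :
    MonoidAlgebra.of ℚ _ h * symmetrizer ε X * MonoidAlgebra.of ℚ _ h⁻¹ =
      symmetrizer ε (X.map h.toEmbedding) := by
  rw [symmetrizer, mul_sum, sum_mul, symmetrizer]
  refine sum_bij' (fun σ _ => h * σ * h⁻¹) (fun σ _ => h⁻¹ * σ * h) ?_ ?_
    (by simp [mul_assoc]) (by simp [mul_assoc]) ?_
  · intro σ hσ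
    rw [mem_supportedOn] at hσ ⊢
    intro i hi
    have := hσ (h⁻¹ i) (fun h' => hi (mem_map.2 ⟨_, h', by simp⟩))
    rw [Perm.mul_apply, Perm.mul_apply, this]
    simp
  · intro σ hσ
    rw [mem_supportedOn] at hσ ⊢
    intro i hi
    have := hσ (h i) (by simpa using hi)
    rw [Perm.mul_apply, Perm.mul_apply, this]
    simp
  · intro σ _
    rw [mul_smul_comm, smul_mul_assoc, ← map_mul, ← map_mul, map_mul ε, map_mul ε, map_inv,
      mul_inv_cancel_comm]

theorem of_mul_rowCol_mul_of_inv (A B : Finset α) (h : Perm α) :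
    MonoidAlgebra.of ℚ _ h * rowCol A B * MonoidAlgebra.of ℚ _ h⁻¹ =
      rowCol (A.map h.toEmbedding) (B.map h.toEmbedding) := by
  rw [rowCol, rowCol, ← of_mul_symmetrizer_mul_of_inv, ← of_mul_symmetrizer_mul_of_inv]
  have : MonoidAlgebra.of ℚ (Perm α) h⁻¹ * MonoidAlgebra.of ℚ (Perm α) h = 1 := by
    rw [← map_mul, inv_mul_cancel, map_one]
  simp only [mul_assoc]
  rw [← mul_assoc (MonoidAlgebra.of ℚ (Perm α) h⁻¹), this, one_mul]

omit [Fintype α] in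
theorem exists_perm_map_eq [Finite α] {B S : Finset α} (h : #B = #S) :
    ∃ σ : Perm α, B.map σ.toEmbedding = S := by
  have e : {x // x ∈ B} ≃ {x // x ∈ S} := Finset.equivOfCardEq h
  refine ⟨e.extendSubtype, ?_⟩
  refine eq_of_subset_of_card_le ?_ (by rw [card_map, h])
  intro x hx
  obtain ⟨y, hy, rfl⟩ := mem_map.1 hx
  exact e.extendSubtype_mem y hy

/-- Averaging a function on the subsets over the images of one subset. -/
theorem sum_map_perm (V : Finset α → ℚ) (B : Finset α) :
    ∑ h : Perm α, V (B.map h.toEmbedding) =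
      ((#B).factorial * (Fintype.card α - #B).factorial : ℕ) * ∑ S ∈ univ.powersetCard #B, V S := by
  have h1 : ∀ S ∈ univ.powersetCard #B, ∑ h : Perm α, V (S.map h.toEmbedding) =
      ∑ h : Perm α, V (B.map h.toEmbedding) := by
    intro S hS
    obtain ⟨σ, hσ⟩ := exists_perm_map_eq (mem_powersetCard.1 hS).2.symm
    refine (Fintype.sum_equiv (Equiv.mulRight σ) _ _ fun h => ?_)
    congr 1
    rw [← hσ]
    ext x
    simp
    rfl
  have h2 : ∑ S ∈ univ.powersetCard #B, ∑ h : Perm α, V (S.map h.toEmbedding) =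
      ∑ h : Perm α, ∑ S ∈ univ.powersetCard #B, V S := by
    rw [sum_comm]
    refine sum_congr rfl fun h _ => ?_
    refine sum_bij' (fun S _ => S.map h.toEmbedding) (fun S _ => S.map h.symm.toEmbedding)
      ?_ ?_ ?_ ?_ ?_
    · intro S hS; simpa [mem_powersetCard] using hS
    · intro S hS; simpa [mem_powersetCard] using hS
    · intro S _; ext; simp
    · intro S _; ext; simp
    · intro S _; rfl
  rw [sum_congr rfl h1, sum_const, sum_const, card_powersetCard, card_univ, card_univ,
    Fintype.card_perm, nsmul_eq_mul, nsmul_eq_mul,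
    ← Nat.choose_mul_factorial_mul_factorial (card_le_univ B)] at h2
  have h3 : ((Fintype.card α).choose #B : ℚ) ≠ 0 := by
    exact_mod_cast (Nat.choose_pos (card_le_univ B)).ne'
  refine mul_left_cancel₀ h3 (h2.trans ?_)
  push_cast
  ring

/-- The conjugates of this element run over all subsets of the same size, and the principal minors
of `g⁻¹` add up to a coefficient of `permPoly`. Up to the factorials this is the character of an
exterior power of the permutation representation. -/
theorem conjTrace_rowCol_compl (g : Perm α) (B : Finset α) :
    conjTrace g (rowCol Bᶜ B) =
      ((#B).factorial * (Fintype.card α - #B).factorial : ℕ) * (permPoly g⁻¹).coeff #B := by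
  rw [coeff_permPoly, ← sum_map_perm (fun S => (rowCol Sᶜ S).coeff g⁻¹), conjTrace_eq_sum]
  refine sum_congr rfl fun h _ => ?_
  have h1 : (B.map h.toEmbedding)ᶜ = Bᶜ.map h.toEmbedding := by
    ext x; simp
  rw [h1, ← of_mul_rowCol_mul_of_inv, MonoidAlgebra.of_apply, MonoidAlgebra.of_apply,
    MonoidAlgebra.coeff_mul_single_apply, MonoidAlgebra.coeff_single_mul_apply, one_mul, mul_one,
    inv_inv, mul_assoc]

omit [Fintype α] [DecidableEq α] in
-- By cyclicity the two copies of `s` reach `U` from either side, and each contributes the same sign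
-- `u`.
theorem conjTrace_mul_of_conj (g : Perm α) {U : MonoidAlgebra ℚ (Perm α)} {s t : Perm α} {u : ℤˣ}
    (hl : MonoidAlgebra.of ℚ _ s * U = ((u : ℤ) : ℚ) • U)
    (hr : U * MonoidAlgebra.of ℚ _ s = ((u : ℤ) : ℚ) • U) :
    conjTrace g (U * MonoidAlgebra.of ℚ _ (s * t * s)) =
      conjTrace g (U * MonoidAlgebra.of ℚ _ t) := by
  rw [map_mul (MonoidAlgebra.of ℚ _), map_mul (MonoidAlgebra.of ℚ _), ← mul_assoc, ← mul_assoc,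
    hr, conjTrace_mul_comm, smul_mul_assoc, mul_smul_comm, ← mul_assoc, hl, smul_mul_assoc, smul_smul, unit_mul_self, one_smul]

omit [Fintype α] in
theorem swap_mul_swap_mul_swap_eq {i i' j : α} (h : i ≠ j) (h' : i' ≠ j) :
    swap i i' * swap i j * swap i i' = swap i' j := by
  rw [mul_swap_eq_swap_mul (swap i i') i j, swap_apply_left,
    swap_apply_of_ne_of_ne h.symm h'.symm, mul_assoc, swap_mul_self, mul_one]

variable {A B : Finset α}

theorem conjTrace_swap_row (g : Perm α) (hAB : Disjoint A B) {i i' j : α} (hi : i ∈ A)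
    (hi' : i' ∈ A) (hj : j ∈ B) :
    conjTrace g (rowCol A B * MonoidAlgebra.of ℚ _ (swap i' j)) =
      conjTrace g (rowCol A B * MonoidAlgebra.of ℚ _ (swap i j)) := by
  have hs := swap_mem_supportedOn hi hi'
  rw [← swap_mul_swap_mul_swap_eq (disjoint_iff_ne.1 hAB i hi j hj)
    (disjoint_iff_ne.1 hAB i' hi' j hj)]
  refine conjTrace_mul_of_conj g (u := (1 : Perm α →* ℤˣ) (swap i i')) ?_ ?_
  · rw [rowCol, ← mul_assoc, of_mul_symmetrizer 1 hs, smul_mul_assoc]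
  · rw [rowCol, mul_assoc, ← of_mul_symmetrizer_comm sign hAB hs, ← mul_assoc,
      symmetrizer_mul_of 1 hs, smul_mul_assoc]

theorem conjTrace_swap_col (g : Perm α) (hAB : Disjoint A B) {i j j' : α} (hi : i ∈ A)
    (hj : j ∈ B) (hj' : j' ∈ B) :
    conjTrace g (rowCol A B * MonoidAlgebra.of ℚ _ (swap j' i)) =
      conjTrace g (rowCol A B * MonoidAlgebra.of ℚ _ (swap j i)) := by
  have hs := swap_mem_supportedOn hj hj'
  rw [← swap_mul_swap_mul_swap_eq (disjoint_iff_ne.1 hAB i hi j hj).symm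
    (disjoint_iff_ne.1 hAB i hi j' hj').symm]
  refine conjTrace_mul_of_conj g (u := sign (swap j j')) ?_ ?_
  · rw [rowCol, ← mul_assoc, of_mul_symmetrizer_comm 1 hAB.symm hs, mul_assoc,
      of_mul_symmetrizer sign hs, mul_smul_comm]
  · rw [rowCol, mul_assoc, symmetrizer_mul_of sign hs, mul_smul_comm]

omit [Fintype α] in
theorem conjTrace_mul_starSum (g : Perm α) (U : MonoidAlgebra ℚ (Perm α)) (o : α) (X : Finset α) :
    conjTrace g (U * starSum 1 o X) =
      ∑ i ∈ X, conjTrace g (U * MonoidAlgebra.of ℚ _ (swap o i)) := by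
  rw [starSum, mul_sum, map_sum]
  simp

theorem conjTrace_rowCol_insert_right (g : Perm α) {o : α} (ho : o ∉ B) :
    conjTrace g (rowCol A (insert o B)) = conjTrace g (rowCol A B) -
      ∑ j ∈ B, conjTrace g (rowCol A B * MonoidAlgebra.of ℚ _ (swap o j)) := by
  rw [rowCol, symmetrizer_insert_right sign ho, ← mul_assoc, starSum_insert sign ho,
    starSum_sign_eq ho, ← sub_eq_add_neg, mul_sub, mul_one, map_sub, ← rowCol,
    conjTrace_mul_starSum]

theorem conjTrace_rowCol_insert_left (g : Perm α) {o : α} (ho : o ∉ A) :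
    conjTrace g (rowCol (insert o A) B) = conjTrace g (rowCol A B) +
      ∑ i ∈ A, conjTrace g (rowCol A B * MonoidAlgebra.of ℚ _ (swap o i)) := by
  rw [rowCol, symmetrizer_insert_left 1 ho, mul_assoc, conjTrace_mul_comm, ← rowCol,
    starSum_insert 1 ho, mul_add, mul_one, map_add, conjTrace_mul_starSum]

/-- The two hooks obtained from a row `A` and a disjoint column `B` by choosing the corner in the
row or in the column. -/
theorem conjTrace_hook_add_hook (g : Perm α) (hAB : Disjoint A B) {o j : α} (ho : o ∈ A)
    (hj : j ∈ B) :
    (#A : ℚ) * conjTrace g (rowCol A (insert o B)) + #B * conjTrace g (rowCol (insert j A) B) =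
      (#A + #B : ℚ) * conjTrace g (rowCol A B) := by
  rw [conjTrace_rowCol_insert_right g (disjoint_left.1 hAB ho),
    conjTrace_rowCol_insert_left g (disjoint_right.1 hAB hj)]
  -- The trace against `(i j)` does not depend on `i ∈ A` and `j ∈ B`, so both correction terms
  -- equal the same double sum and cancel.
  have h1 : (#A : ℚ) * ∑ j ∈ B, conjTrace g (rowCol A B * MonoidAlgebra.of ℚ _ (swap o j)) =
      ∑ i ∈ A, ∑ j ∈ B, conjTrace g (rowCol A B * MonoidAlgebra.of ℚ _ (swap i j)) := by
    rw [← nsmul_eq_mul, ← sum_const]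
    exact sum_congr rfl fun i hi => sum_congr rfl fun j hj => conjTrace_swap_row g hAB hi ho hj
  have h2 : (#B : ℚ) * ∑ i ∈ A, conjTrace g (rowCol A B * MonoidAlgebra.of ℚ _ (swap j i)) =
      ∑ i ∈ A, ∑ j ∈ B, conjTrace g (rowCol A B * MonoidAlgebra.of ℚ _ (swap i j)) := by
    rw [← nsmul_eq_mul, ← sum_const, sum_comm (s := A)]
    refine sum_congr rfl fun j' hj' => sum_congr rfl fun i hi => ?_
    rw [conjTrace_swap_col g hAB hi hj' hj, swap_comm]
  linear_combination h2 - h1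

/-- The traces of the Young symmetrizers of hooks. -/
theorem conjTrace_hook (g : Perm α) {Y : Polynomial ℚ}
    (hY : (1 + Polynomial.X) * Y = permPoly g⁻¹) (B : Finset α) (o : α) (ho : o ∉ B) :
    conjTrace g (rowCol Bᶜ (insert o B)) =
      (Fintype.card α * ((#B).factorial * (Fintype.card α - #B - 1).factorial) : ℕ) *
        Y.coeff #B := by
  have hlt : #B < Fintype.card α := card_lt_univ_of_notMem ho
  induction hk : #B generalizing B o with
  | zero =>
    rw [card_eq_zero] at hk
    subst hk
    rw [conjTrace_rowCol_insert_right g ho, sum_empty, sub_zero, conjTrace_rowCol_compl, ← hY]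
    rw [card_empty] at hlt
    obtain ⟨m, hm⟩ := Nat.exists_eq_succ_of_ne_zero hlt.ne'
    simp [add_mul, hm, Nat.factorial_succ]
  | succ k ih =>
    obtain ⟨j, hj⟩ := card_pos.1 (by omega : 0 < #B)
    -- The second hook in this relation has leg `B.erase j`, to which the induction hypothesis
    -- applies. What remains is the recursion `Y_{k+1} + Y_k = [X^{k+1}] (1 + X) Y`.
    have h1 := conjTrace_hook_add_hook g (A := Bᶜ) (B := B) (disjoint_compl_left)
      (mem_compl.2 ho) hj
    have hjB : insert j (B.erase j) = B := insert_erase hj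
    have hjA : insert j Bᶜ = (B.erase j)ᶜ := (compl_erase).symm
    have hcard : #(B.erase j) = k := by rw [card_erase_of_mem hj]; omega
    have h2 := ih (B.erase j) j (notMem_erase j B) (by omega) hcard
    rw [hjB, ← hjA] at h2
    rw [h2, conjTrace_rowCol_compl, ← hY, card_compl, hk, add_mul (1 : Polynomial ℚ),
      Polynomial.coeff_add, one_mul, Polynomial.coeff_X_mul] at h1
    obtain ⟨m, hm⟩ := Nat.exists_eq_add_of_lt hlt
    rw [hk] at hm
    have e1 : Fintype.card α - (k + 1) = m + 1 := by omega
    have e2 : Fintype.card α - k - 1 = m + 1 := by omega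
    rw [e1, e2] at h1
    rw [e1, Nat.add_sub_cancel]
    have hm0 : ((m + 1 : ℕ) : ℚ) ≠ 0 := by exact_mod_cast Nat.succ_ne_zero m
    refine mul_left_cancel₀ hm0 ?_
    rw [hm] at h1 ⊢
    push_cast [Nat.factorial_succ] at h1 ⊢
    linear_combination h1

end ConjTrace

end CompletedCycles

namespace CompletedCycles

open Finset Equiv Equiv.Perm

/-! ### Characters of Specht modules; hooks. -/

section Characters

variable {d : ℕ} {lam : d.Partition}

theorem coe_spechtRep_apply (g : Perm (Fin d)) (x : spechtModule lam) :
    (spechtRep lam g x : MonoidAlgebra ℚ (Perm (Fin d))) = MonoidAlgebra.of ℚ _ g * x := rfl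

/-- Right multiplication by the idempotent `m⁻¹ y` projects the group algebra onto the left ideal
generated by `y`, so the trace on the ideal can be taken on the whole algebra. -/
theorem character_spechtRep {m : ℚ} (hm : m ≠ 0)
    (h : youngSymmetrizer (tableau lam) * youngSymmetrizer (tableau lam) =
      m • youngSymmetrizer (tableau lam)) (g : Perm (Fin d)) :
    (spechtRep lam).character g = m⁻¹ * conjTrace g (youngSymmetrizer (tableau lam)) := by
  set y := youngSymmetrizer (tableau lam) with hy
  let p : Submodule ℚ (MonoidAlgebra ℚ (Perm (Fin d))) := (spechtModule lam).restrictScalars ℚ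
  let f : MonoidAlgebra ℚ (Perm (Fin d)) →ₗ[ℚ] MonoidAlgebra ℚ (Perm (Fin d)) :=
    m⁻¹ • (LinearMap.mulLeft ℚ (MonoidAlgebra.of ℚ (Perm (Fin d)) g) * LinearMap.mulRight ℚ y)
  have hfx : ∀ x, f x = m⁻¹ • (MonoidAlgebra.of ℚ (Perm (Fin d)) g * (x * y)) := fun x => rfl
  have hf : ∀ x, f x ∈ p := by
    intro x
    rw [hfx]
    refine p.smul_mem _ ?_
    change _ ∈ Submodule.span _ {y}
    rw [Submodule.mem_span_singleton]
    exact ⟨MonoidAlgebra.of ℚ (Perm (Fin d)) g * x, by rw [smul_eq_mul, mul_assoc]⟩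
  have h1 := LinearMap.trace_restrict_eq_of_forall_mem p f hf
  let e : spechtModule lam ≃ₗ[ℚ] p :=
    { toFun := fun x => ⟨x.1, x.2⟩
      map_add' := fun _ _ => rfl
      map_smul' := fun _ _ => rfl
      invFun := fun x => ⟨x.1, x.2⟩
      left_inv := fun _ => rfl
      right_inv := fun _ => rfl }
  have h2 : f.restrict (fun x _ => hf x) = e.conj (spechtRep lam g) := by
    refine LinearMap.ext fun x => Subtype.ext ?_
    obtain ⟨x, hx⟩ := x
    obtain ⟨z, rfl⟩ := Submodule.mem_span_singleton.1 hx
    rw [LinearMap.restrict_apply]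
    change f (z • y) = MonoidAlgebra.of ℚ _ g * (z • y)
    rw [hfx, smul_eq_mul, mul_assoc z, h, mul_smul_comm, mul_smul_comm, smul_smul,
      inv_mul_cancel₀ hm, one_smul]
  rw [h2, LinearMap.trace_conj'] at h1
  refine Eq.trans h1 ?_
  rw [conjTrace_apply, map_smul, smul_eq_mul]

/-- A sum over a conjugation-invariant set is central, so killing the generator means killing the
whole left ideal. -/
theorem sum_character_spechtRep_eq_zero (K : Finset (Perm (Fin d)))
    (hK : ∀ σ ∈ K, ∀ τ : Perm (Fin d), τ * σ * τ⁻¹ ∈ K)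
    (h : (∑ σ ∈ K, MonoidAlgebra.of ℚ _ σ) * youngSymmetrizer (tableau lam) = 0) :
    ∑ σ ∈ K, (spechtRep lam).character σ = 0 := by
  have hcomm : ∀ z : MonoidAlgebra ℚ (Perm (Fin d)),
      (∑ σ ∈ K, MonoidAlgebra.of ℚ _ σ) * z = z * ∑ σ ∈ K, MonoidAlgebra.of ℚ _ σ := by
    intro z
    induction z using MonoidAlgebra.induction_on with
    | of τ =>
      rw [sum_mul, mul_sum]
      refine sum_bij' (fun σ _ => τ⁻¹ * σ * τ) (fun σ _ => τ * σ * τ⁻¹)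
        (fun σ hσ => by simpa using hK σ hσ τ⁻¹) (fun σ hσ => hK σ hσ τ)
        (by simp [mul_assoc]) (by simp [mul_assoc]) ?_
      intro σ _
      rw [← map_mul, ← map_mul]
      simp [mul_assoc]
    | add x y hx hy => rw [mul_add, add_mul, hx, hy]
    | smul r x hx => rw [mul_smul_comm, smul_mul_assoc, hx]
  have h1 : ∑ σ ∈ K, spechtRep lam σ = 0 := by
    ext1 x
    apply Subtype.ext
    obtain ⟨x, hx⟩ := x
    obtain ⟨z, rfl⟩ := Submodule.mem_span_singleton.1 hx
    rw [LinearMap.sum_apply, Submodule.coe_sum]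
    simp only [coe_spechtRep_apply]
    rw [← sum_mul, LinearMap.zero_apply, Submodule.coe_zero, smul_eq_mul, ← mul_assoc, hcomm,
      mul_assoc, h, mul_zero]
  simp only [Representation.character]
  rw [← map_sum, h1, map_zero]

/-- The numbers in the first row of a tableau. -/
def firstRow (T : Tableau lam) : Finset (Fin d) := {i | (T.symm i).1.1 = 0}

/-- The numbers in the first column of a tableau. -/
def firstCol (T : Tableau lam) : Finset (Fin d) := {i | (T.symm i).1.2 = 0}

theorem fst_eq_zero_or_snd_eq_zero (h : (1, 1) ∉ diagram lam) (c : (diagram lam).cells) :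
    c.1.1 = 0 ∨ c.1.2 = 0 := by
  by_contra hcon
  push Not at hcon
  exact h ((diagram lam).up_left_mem (Nat.one_le_iff_ne_zero.2 hcon.1)
    (Nat.one_le_iff_ne_zero.2 hcon.2) c.2)

/-- In a hook, a cell outside the first row is alone in its row. -/
theorem rowStabilizer_eq (h : (1, 1) ∉ diagram lam) (T : Tableau lam) :
    rowStabilizer T = supportedOn (firstRow T) := by
  ext σ
  rw [mem_supportedOn, rowStabilizer, mem_filter]
  simp only [mem_univ, true_and, firstRow, mem_filter]
  constructor
  · intro hσ i hi
    have h1 := (fst_eq_zero_or_snd_eq_zero h (T.symm i)).resolve_left hi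
    have h2 := (fst_eq_zero_or_snd_eq_zero h (T.symm (σ i))).resolve_left (by rw [hσ i]; exact hi)
    exact T.symm.injective (Subtype.ext (Prod.ext (hσ i) (h2.trans h1.symm)))
  · intro hσ i
    by_cases hi : (T.symm i).1.1 = 0
    · rw [hi]
      by_contra h1
      have := hσ _ h1
      rw [σ.injective this] at h1
      exact h1 hi
    · rw [hσ i hi]

theorem colStabilizer_eq (h : (1, 1) ∉ diagram lam) (T : Tableau lam) :
    colStabilizer T = supportedOn (firstCol T) := by
  ext σ
  rw [mem_supportedOn, colStabilizer, mem_filter]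
  simp only [mem_univ, true_and, firstCol, mem_filter]
  constructor
  · intro hσ i hi
    have h1 := (fst_eq_zero_or_snd_eq_zero h (T.symm i)).resolve_right hi
    have h2 := (fst_eq_zero_or_snd_eq_zero h (T.symm (σ i))).resolve_right (by rw [hσ i]; exact hi)
    exact T.symm.injective (Subtype.ext (Prod.ext (h2.trans h1.symm) (hσ i)))
  · intro hσ i
    by_cases hi : (T.symm i).1.2 = 0
    · rw [hi]
      by_contra h1
      have := hσ _ h1
      rw [σ.injective this] at h1
      exact h1 hi
    · rw [hσ i hi]

theorem youngSymmetrizer_eq_rowCol (h : (1, 1) ∉ diagram lam) (T : Tableau lam) :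
    youngSymmetrizer T = rowCol (firstRow T) (firstCol T) := by
  rw [youngSymmetrizer, rowStabilizer_eq h, colStabilizer_eq h, rowCol, symmetrizer, symmetrizer]
  simp

theorem colLen_diagram_zero : (diagram lam).colLen 0 = Multiset.card lam.parts := by
  rw [← YoungDiagram.length_rowLens, diagram, YoungDiagram.rowLens_ofRowLens_eq_self]
  · simp
  · intro x hx
    exact lam.parts_pos ((Multiset.mem_sort _).1 hx)

theorem card_firstCol (T : Tableau lam) : #(firstCol T) = Multiset.card lam.parts := by
  rw [← colLen_diagram_zero, YoungDiagram.colLen_eq_card]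
  refine card_bij (fun i _ => (T.symm i).1) ?_ ?_ ?_
  · intro i hi
    rw [YoungDiagram.mem_col_iff]
    exact ⟨(T.symm i).2, by simpa [firstCol] using hi⟩
  · intro i _ j _ hij
    exact T.symm.injective (Subtype.ext hij)
  · intro c hc
    rw [YoungDiagram.mem_col_iff] at hc
    exact ⟨T ⟨c, hc.1⟩, by simp [firstCol, hc.2], by simp⟩

theorem zero_mem_diagram (hd : 0 < d) : (0, 0) ∈ diagram lam := by
  have h : 0 < #(diagram lam).cells := by rw [card_diagram]; exact hd
  obtain ⟨c, hc⟩ := card_pos.1 h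
  exact (diagram lam).up_left_mem (Nat.zero_le _) (Nat.zero_le _) hc

/-- The characters of the symmetric group attached to hooks. -/
theorem chi_hook (hd : 0 < d) (h : (1, 1) ∉ diagram lam) (mu : d.Partition) {Y : Polynomial ℚ}
    (hY : (1 + Polynomial.X) * Y = (mu.parts.map fun c => 1 - (-Polynomial.X) ^ c).prod) :
    chi lam mu = Y.coeff (Multiset.card lam.parts - 1) := by
  have hg := (exists_perm_of_partition mu).choose_spec
  rw [chi]
  set g := (exists_perm_of_partition mu).choose
  set T := tableau lam with hT
  set o := T ⟨(0, 0), zero_mem_diagram hd⟩ with ho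
  set B := (firstCol T).erase o with hB
  have hoC : o ∈ firstCol T := by simp [firstCol, ho]
  have hoB : o ∉ B := notMem_erase _ _
  have hC : insert o B = firstCol T := insert_erase hoC
  have hR : firstRow T = Bᶜ := by
    ext i
    have h1 := fst_eq_zero_or_snd_eq_zero h (T.symm i)
    have h2 : i = o ↔ (T.symm i).1.1 = 0 ∧ (T.symm i).1.2 = 0 := by
      rw [ho, ← T.symm_apply_eq, Subtype.ext_iff, Prod.ext_iff]
    simp only [hB, mem_compl, mem_erase, firstRow, firstCol, mem_filter, mem_univ, true_and, ne_eq,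
      h2]
    tauto
  have hcard : #B = Multiset.card lam.parts - 1 := by
    rw [hB, card_erase_of_mem hoC, card_firstCol]
  have hA : insert o (Bᶜ.erase o) = Bᶜ := insert_erase (mem_compl.2 hoB)
  have hlt : #B < d := by simpa using card_lt_univ_of_notMem hoB
  have hAcard : #(Bᶜ.erase o) = d - #B - 1 := by
    rw [card_erase_of_mem (mem_compl.2 hoB), card_compl, Fintype.card_fin]
  have hsq := rowCol_mul_self (A := Bᶜ.erase o) (B := B) (o := o) (notMem_erase _ _) hoB
    (disjoint_of_subset_left (erase_subset _ _) disjoint_compl_left)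
  have hsum : d - #B - 1 + #B + 1 = d := by omega
  rw [hAcard, hsum, hA, hC, ← hR, ← youngSymmetrizer_eq_rowCol h] at hsq
  have hm : ((d * ((#B).factorial * (d - #B - 1).factorial) : ℕ) : ℚ) ≠ 0 := by
    exact_mod_cast (Nat.mul_pos hd (Nat.mul_pos (Nat.factorial_pos _) (Nat.factorial_pos _))).ne'
  -- The trace formula involves `g⁻¹`, which has the same cycle type as `g`.
  have hY' : (1 + Polynomial.X) * Y = permPoly g⁻¹ := by
    have h3 : g⁻¹.partition.parts = g.partition.parts := by
      rw [parts_partition, parts_partition, cycleType_inv, support_inv]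
    rw [hY, permPoly_eq, h3, hg]
  have hF := conjTrace_hook g hY' B o hoB
  rw [hC, ← hR, ← youngSymmetrizer_eq_rowCol h, Fintype.card_fin] at hF
  rw [character_spechtRep hm hsq, hF, ← mul_assoc, inv_mul_cancel₀ hm, one_mul, hcard]

end Characters

end CompletedCycles

namespace CompletedCycles

open Finset Equiv Equiv.Perm

/-! ### The sum of the full cycles kills the symmetrizer of a square. -/

section FullCycles

/-- All points of `S` lie on one cycle of `σ`. -/
def OneCycleOn {α : Type*} (S : Finset α) (σ : Perm α) : Prop :=
  ∀ i ∈ S, ∀ j ∈ S, σ.SameCycle i j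

/-- The row stabilizer of the square tableau with rows `0 1` and `2 3`. -/
def squareRow : Finset (Perm (Fin 4)) := {1, swap 0 1, swap 2 3, swap 0 1 * swap 2 3}

/-- The column stabilizer of the square tableau with rows `0 1` and `2 3`. -/
def squareCol : Finset (Perm (Fin 4)) := {1, swap 0 2, swap 1 3, swap 0 2 * swap 1 3}

/-- Replaces the cycle condition by one on the orbit of `0` that can be decided by evaluation. -/
theorem oneCycleOn_univ_iff (σ : Perm (Fin 4)) :
    OneCycleOn univ σ ↔ σ 0 ≠ 0 ∧ σ (σ 0) ≠ 0 ∧ σ (σ (σ 0)) ≠ 0 := by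
  have key : ∀ τ : Perm (Fin 4), (∀ j, j = 0 ∨ j = τ 0 ∨ j = τ (τ 0) ∨ j = τ (τ (τ 0))) ↔
      τ 0 ≠ 0 ∧ τ (τ 0) ≠ 0 ∧ τ (τ (τ 0)) ≠ 0 := by decide
  have closed : ∀ τ : Perm (Fin 4), ∀ j, (j = 0 ∨ j = τ 0 ∨ j = τ (τ 0) ∨ j = τ (τ (τ 0))) →
      (τ j = 0 ∨ τ j = τ 0 ∨ τ j = τ (τ 0) ∨ τ j = τ (τ (τ 0))) := by decide
  have h1 : σ.SameCycle 0 (σ 0) := sameCycle_apply_right.2 (SameCycle.refl _ _)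
  have h2 : σ.SameCycle 0 (σ (σ 0)) := sameCycle_apply_right.2 h1
  have h3 : σ.SameCycle 0 (σ (σ (σ 0))) := sameCycle_apply_right.2 h2
  rw [← key]
  constructor
  · intro h j
    obtain ⟨k, rfl⟩ := (h 0 (mem_univ _) j (mem_univ _)).exists_nat_pow_eq
    induction k with
    | zero => simp
    | succ k ih =>
      rw [pow_succ', Perm.mul_apply]
      exact closed σ _ ih
  · intro h
    have h0 : ∀ j, σ.SameCycle 0 j := by
      intro j
      rcases h j with rfl | rfl | rfl | rfl
      exacts [SameCycle.refl _ _, h1, h2, h3]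
    exact fun i _ j _ => (h0 i).symm.trans (h0 j)

open Classical in
-- A finite check in `S_4`; it reflects that the character of shape `(2, 2)` vanishes at 4-cycles.
theorem square_sum_eq_zero (x : Perm (Fin 4)) :
    ∑ r ∈ squareRow, ∑ k ∈ squareCol, ((sign k : ℤ) : ℚ) *
      (if OneCycleOn univ (x * (r * k)⁻¹) then 1 else 0) = 0 := by
  have key : ∀ x : Perm (Fin 4), ∑ r ∈ squareRow, ∑ k ∈ squareCol, (sign k : ℤ) *
      (if (x * (r * k)⁻¹) 0 ≠ 0 ∧ (x * (r * k)⁻¹) ((x * (r * k)⁻¹) 0) ≠ 0 ∧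
        (x * (r * k)⁻¹) ((x * (r * k)⁻¹) ((x * (r * k)⁻¹) 0)) ≠ 0 then 1 else 0) = 0 := by
    decide +kernel
  simp only [oneCycleOn_univ_iff]
  have h := congrArg (Int.cast : ℤ → ℚ) (key x)
  rw [Int.cast_sum, Int.cast_zero] at h
  rw [← h]
  refine sum_congr rfl fun r _ => ?_
  rw [Int.cast_sum]
  refine sum_congr rfl fun k _ => ?_
  rw [Int.cast_mul, Int.cast_ite, Int.cast_one, Int.cast_zero]
  congr

variable {α : Type*} [DecidableEq α]

/-- Multiplying by `(a σa)` cuts `a` out of its cycle: the predecessor of `a` is sent to `σ a`, and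
`a` becomes fixed. -/
theorem sameCycle_swap_mul {σ : Perm α} {a : α} (ha : σ a ≠ a) {i j : α} (hi : i ≠ a)
    (hj : j ≠ a) : (swap a (σ a) * σ).SameCycle i j ↔ σ.SameCycle i j := by
  set τ := swap a (σ a) * σ with hτ
  have happ : ∀ l, τ l = if σ l = a then σ a else if l = a then a else σ l := by
    intro l
    rw [hτ, Perm.mul_apply, swap_apply_def]
    simp only [σ.injective.eq_iff]
  constructor
  · rintro ⟨k, rfl⟩
    have hstep : ∀ l, σ.SameCycle l (τ l) := by
      intro l
      rw [happ]
      split_ifs with h1 h2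
      · rw [← h1]
        exact sameCycle_apply_right.2 (sameCycle_apply_right.2 (SameCycle.refl _ _))
      · rw [h2]
      · exact sameCycle_apply_right.2 (SameCycle.refl _ _)
    clear hj
    induction k with
    | zero => exact SameCycle.refl _ _
    | succ n ih =>
      rw [add_comm, zpow_add, zpow_one, Perm.mul_apply]
      exact ih.trans (hstep _)
    | pred n ih =>
      have h1 := hstep ((τ ^ (-(n : ℤ) - 1)) i)
      rw [← Perm.mul_apply, ← zpow_one_add, add_sub_cancel] at h1
      exact ih.trans h1.symm
  · rintro ⟨k, hk⟩
    -- `ρ` replaces the removed point by its successor, so that each step of `σ` projects to at most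
    -- one step of `τ`.
    let ρ : α → α := fun l => if l = a then σ a else l
    have hstep : ∀ l, τ.SameCycle (ρ l) (ρ (σ l)) := by
      intro l
      by_cases h1 : l = a
      · subst h1
        simp only [ρ, if_pos, if_neg ha]
        exact SameCycle.refl _ _
      · have h2 : τ l = ρ (σ l) := by
          rw [happ]
          simp only [ρ]
          split_ifs <;> rfl
        rw [← h2]
        simp only [ρ, if_neg h1]
        exact sameCycle_apply_right.2 (SameCycle.refl _ _)
    have hpow : ∀ k : ℤ, τ.SameCycle (ρ i) (ρ ((σ ^ k) i)) := by
      intro k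
      induction k with
      | zero => exact SameCycle.refl _ _
      | succ n ih =>
        rw [add_comm, zpow_add, zpow_one, Perm.mul_apply]
        exact ih.trans (hstep _)
      | pred n ih =>
        have h1 := hstep ((σ ^ (-(n : ℤ) - 1)) i)
        rw [← Perm.mul_apply, ← zpow_one_add, add_sub_cancel] at h1
        exact ih.trans h1.symm
    have h3 := hpow k
    rw [hk] at h3
    simpa only [ρ, if_neg hi, if_neg hj] using h3

variable [Fintype α]

theorem oneCycleOn_iff_erase {S : Finset α} {σ : Perm α} (hσ : σ ∈ supportedOn S) {a : α}
    (ha : a ∈ S) (hne : σ a ≠ a) :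
    OneCycleOn S σ ↔ OneCycleOn (S.erase a) (swap a (σ a) * σ) := by
  constructor
  · intro h i hi j hj
    rw [mem_erase] at hi hj
    exact (sameCycle_swap_mul hne hi.1 hj.1).2 (h i hi.2 j hj.2)
  · intro h
    have hσa : σ a ∈ S.erase a := mem_erase.2 ⟨hne, apply_mem_of_mem_supportedOn hσ ha⟩
    have h0 : ∀ i ∈ S, σ.SameCycle (σ a) i := by
      intro i hi
      by_cases hia : i = a
      · rw [hia]; exact sameCycle_apply_left.2 (SameCycle.refl _ _)
      · exact (sameCycle_swap_mul hne hne hia).1 (h _ hσa i (mem_erase.2 ⟨hia, hi⟩))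
    exact fun i hi j hj => (h0 i hi).symm.trans (h0 j hj)

omit [Fintype α] [DecidableEq α] in
theorem oneCycleOn_map_viaEmbedding (f : Fin 4 ↪ α) (σ : Perm (Fin 4)) :
    OneCycleOn (univ.map f) (viaEmbeddingHom f σ) ↔ OneCycleOn univ σ := by
  have h : ∀ i j, (viaEmbeddingHom f σ).SameCycle (f i) (f j) ↔ σ.SameCycle i j := by
    classical
    intro i j
    have hz : ∀ k : ℤ, ((viaEmbeddingHom f σ) ^ k) (f i) = f ((σ ^ k) i) := by
      intro k
      rw [← map_zpow, viaEmbeddingHom_apply, viaEmbedding_apply]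
    exact exists_congr fun k => by rw [hz, f.injective.eq_iff]
  constructor
  · intro H i _ j _
    exact (h i j).1 (H _ (mem_map_of_mem f (mem_univ i)) _ (mem_map_of_mem f (mem_univ j)))
  · intro H i hi j hj
    obtain ⟨i, -, rfl⟩ := mem_map.1 hi
    obtain ⟨j, -, rfl⟩ := mem_map.1 hj
    exact (h i j).2 (H i (mem_univ i) j (mem_univ j))

theorem viaEmbeddingHom_mem_supportedOn (f : Fin 4 ↪ α) (σ : Perm (Fin 4)) :
    viaEmbeddingHom f σ ∈ supportedOn (univ.map f) := by
  rw [mem_supportedOn]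
  intro i hi
  rw [viaEmbeddingHom_apply]
  exact viaEmbedding_apply_of_notMem _ _ _ (by simpa using hi)

theorem exists_viaEmbeddingHom_eq (f : Fin 4 ↪ α) {x : Perm α}
    (hx : x ∈ supportedOn (univ.map f)) : ∃ y, viaEmbeddingHom f y = x := by
  have h1 : ∀ i, ∃ j, f j = x (f i) := by
    intro i
    have := apply_mem_of_mem_supportedOn hx (mem_map_of_mem f (mem_univ i))
    simpa using this
  choose y hy using h1
  have hinj : Function.Injective y := by
    intro i j hij
    have h2 := hy i
    rw [hij, hy j] at h2
    exact f.injective (x.injective h2.symm)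
  refine ⟨Equiv.ofBijective y (Finite.injective_iff_bijective.1 hinj), ?_⟩
  ext1 i
  rw [viaEmbeddingHom_apply]
  by_cases hi : i ∈ univ.map f
  · obtain ⟨i, -, rfl⟩ := mem_map.1 hi
    rw [viaEmbedding_apply]
    exact hy i
  · rw [viaEmbedding_apply_of_notMem _ _ _ (by simpa using hi), mem_supportedOn.1 hx i hi]

open Classical in
/-- The signed count of full cycles vanishes on each translate of the symmetrizer of a square. -/
theorem square_sum_viaEmbedding_eq_zero (f : Fin 4 ↪ α) (S : Finset α) (hS : univ.map f ⊆ S)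
    (x : Perm α) (hx : x ∈ supportedOn S) :
    ∑ r ∈ squareRow, ∑ k ∈ squareCol, ((sign k : ℤ) : ℚ) *
      (if OneCycleOn S (x * viaEmbeddingHom f (r * k)⁻¹) then 1 else 0) = 0 := by
  induction S using Finset.strongInduction generalizing x with
  | H S ih =>
    -- A point `a` off the square has the same image under all the products, as the square
    -- permutations act first and fix it. If `x` fixes `a`, no term is a full cycle; otherwise the
    -- same transposition on the left cuts `a` out of every term.
    by_cases hex : ∃ a ∈ S, a ∉ univ.map f
    · obtain ⟨a, haS, haf⟩ := hex
      have hfix : ∀ z, (x * viaEmbeddingHom f z) a = x a := by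
        intro z
        rw [Perm.mul_apply, mem_supportedOn.1 (viaEmbeddingHom_mem_supportedOn f z) a haf]
      have hmem : ∀ z, x * viaEmbeddingHom f z ∈ supportedOn S := fun z =>
        mul_mem_supportedOn hx (supportedOn_mono hS (viaEmbeddingHom_mem_supportedOn f z))
      by_cases hxa : x a = a
      · refine sum_eq_zero fun r _ => sum_eq_zero fun k _ => ?_
        rw [if_neg, mul_zero]
        intro h
        have h0 : f 0 ∈ univ.map f := mem_map_of_mem f (mem_univ 0)
        have h1 := h a haS (f 0) (hS h0)
        rw [sameCycle_comm] at h1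
        have h2 := (h1.apply_eq_self_iff).2 ((hfix _).trans hxa)
        have h3 := h1.eq_of_left h2
        exact haf (h3 ▸ h0)
      · have h1 := ih (S.erase a) (erase_ssubset haS)
          (fun i hi => mem_erase.2 ⟨fun h => haf (h ▸ hi), hS hi⟩) (swap a (x a) * x) (by
            rw [mem_supportedOn]
            intro i hi
            by_cases hia : i = a
            · rw [hia, Perm.mul_apply, swap_apply_right]
            · have hiS : i ∉ S := fun h => hi (mem_erase.2 ⟨hia, h⟩)
              have hxa' := apply_mem_of_mem_supportedOn hx haS
              rw [Perm.mul_apply, mem_supportedOn.1 hx i hiS,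
                swap_apply_of_ne_of_ne hia (fun h => hiS (h ▸ hxa'))])
        refine Eq.trans ?_ h1
        refine sum_congr rfl fun r _ => sum_congr rfl fun k _ => ?_
        have h2 := oneCycleOn_iff_erase (hmem (r * k)⁻¹) haS (by rw [hfix]; exact hxa)
        rw [hfix, ← mul_assoc] at h2
        simp only [h2]
    · push Not at hex
      have hSf : S = univ.map f := Subset.antisymm hex hS
      subst hSf
      obtain ⟨y, rfl⟩ := exists_viaEmbeddingHom_eq f hx
      simp only [← map_mul, oneCycleOn_map_viaEmbedding]
      exact square_sum_eq_zero y

open Classical in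
/-- The sum of the full cycles in the group algebra is killed by the symmetrizer of a square. -/
theorem fullCycles_mul_square (f : Fin 4 ↪ α) :
    (∑ σ : Perm α with OneCycleOn univ σ, MonoidAlgebra.of ℚ (Perm α) σ) *
      ((∑ r ∈ squareRow, MonoidAlgebra.of ℚ (Perm α) (viaEmbeddingHom f r)) *
        ∑ k ∈ squareCol, ((sign k : ℤ) : ℚ) • MonoidAlgebra.of ℚ (Perm α) (viaEmbeddingHom f k)) =
      0 := by
  ext x
  refine Eq.trans ?_
    (square_sum_viaEmbedding_eq_zero f univ (subset_univ _) x (by simp [mem_supportedOn]))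
  rw [sum_mul_sum, mul_sum, MonoidAlgebra.coeff_sum, Finsupp.finsetSum_apply]
  refine sum_congr rfl fun r _ => ?_
  rw [mul_sum, MonoidAlgebra.coeff_sum, Finsupp.finsetSum_apply]
  refine sum_congr rfl fun k _ => ?_
  rw [mul_smul_comm, mul_smul_comm, ← map_mul, ← map_mul, MonoidAlgebra.coeff_smul_apply,
    smul_eq_mul, MonoidAlgebra.of_apply, MonoidAlgebra.coeff_mul_single_apply, mul_one, ← map_inv,
    MonoidAlgebra.coeff_sum, Finsupp.finsetSum_apply]
  congr 1
  simp only [MonoidAlgebra.of_apply, MonoidAlgebra.coeff_single, Finsupp.single_apply]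
  rw [sum_ite_eq']
  simp

end FullCycles

/-! ### Vanishing at full cycles for non-hooks. -/

section NonHooks

variable {d : ℕ} {lam : d.Partition}

theorem isCycle_of_parts_eq (hd : 2 ≤ d) {σ : Perm (Fin d)} (h : σ.partition.parts = {d}) :
    σ.IsCycle ∧ σ.support = univ := by
  rw [parts_partition, Fintype.card_fin] at h
  have h1 := congrArg Multiset.card h
  rw [Multiset.card_add, Multiset.card_replicate, Multiset.card_singleton] at h1
  have hsupp : #σ.support ≤ d := by simpa using card_le_univ σ.support
  have h2 : Multiset.card σ.cycleType ≠ 0 := by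
    intro h0
    rw [Multiset.card_eq_zero, cycleType_eq_zero] at h0
    subst h0
    simp at h1
    omega
  refine ⟨card_cycleType_eq_one.1 (by omega), ?_⟩
  rw [← card_eq_iff_eq_univ, Fintype.card_fin]
  omega

theorem isCycle_of_oneCycleOn (hd : 2 ≤ d) {σ : Perm (Fin d)} (h : OneCycleOn univ σ) :
    σ.IsCycle ∧ σ.support = univ := by
  have hmove : ∀ i, σ i ≠ i := by
    intro i hi
    have : Nontrivial (Fin d) := Fin.nontrivial_iff_two_le.2 hd
    obtain ⟨j, hj⟩ := exists_ne i
    exact hj ((h i (mem_univ i) j (mem_univ j)).eq_of_left hi).symm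
  refine ⟨⟨⟨0, by omega⟩, hmove _, fun j _ => h _ (mem_univ _) j (mem_univ j)⟩, ?_⟩
  ext i
  simp [hmove i]

theorem oneCycleOn_conj {α : Type*} [Fintype α] {σ : Perm α} (h : OneCycleOn univ σ)
    (τ : Perm α) : OneCycleOn univ (τ * σ * τ⁻¹) :=
  fun _ _ _ _ => sameCycle_conj.2 (h _ (mem_univ _) _ (mem_univ _))

theorem sum_rowStabilizer_mul_of {T : Tableau lam} {σ : Perm (Fin d)} (hσ : σ ∈ rowStabilizer T) :
    (∑ p ∈ rowStabilizer T, MonoidAlgebra.of ℚ _ p) * MonoidAlgebra.of ℚ _ σ =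
      ∑ p ∈ rowStabilizer T, MonoidAlgebra.of ℚ _ p := by
  simp only [rowStabilizer, mem_filter, mem_univ, true_and] at hσ
  rw [sum_mul]
  refine sum_bij' (fun τ _ => τ * σ) (fun τ _ => τ * σ⁻¹) ?_ ?_ (by simp) (by simp) ?_
  · intro τ hτ
    simp only [rowStabilizer, mem_filter, mem_univ, true_and] at hτ ⊢
    intro i
    rw [Perm.mul_apply, hτ, hσ]
  · intro τ hτ
    simp only [rowStabilizer, mem_filter, mem_univ, true_and] at hτ ⊢
    intro i
    have := hσ (σ⁻¹ i)
    rw [Perm.mul_apply, hτ, ← this]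
    simp
  · intro τ _
    rw [map_mul]

theorem of_mul_sum_colStabilizer {T : Tableau lam} {σ : Perm (Fin d)} (hσ : σ ∈ colStabilizer T) :
    MonoidAlgebra.of ℚ _ σ *
        ∑ q ∈ colStabilizer T, ((sign q : ℤ) : ℚ) • MonoidAlgebra.of ℚ _ q =
      ((sign σ : ℤ) : ℚ) • ∑ q ∈ colStabilizer T, ((sign q : ℤ) : ℚ) • MonoidAlgebra.of ℚ _ q := by
  simp only [colStabilizer, mem_filter, mem_univ, true_and] at hσ
  rw [mul_sum, smul_sum]
  refine sum_bij' (fun τ _ => σ * τ) (fun τ _ => σ⁻¹ * τ) ?_ ?_ (by simp) (by simp) ?_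
  · intro τ hτ
    simp only [colStabilizer, mem_filter, mem_univ, true_and] at hτ ⊢
    intro i
    rw [Perm.mul_apply, hσ, hτ]
  · intro τ hτ
    simp only [colStabilizer, mem_filter, mem_univ, true_and] at hτ ⊢
    intro i
    have := hσ (σ⁻¹ (τ i))
    rw [Perm.mul_apply, ← hτ i, ← this]
    simp
  · intro τ _
    rw [mul_smul_comm, ← map_mul, smul_smul, Perm.sign_mul, Units.val_mul, Int.cast_mul, ← mul_assoc,
      unit_mul_self, one_mul]

theorem square_mem_diagram (h : (1, 1) ∈ diagram lam) (j : Fin 4) :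
    (j.val / 2, j.val % 2) ∈ diagram lam :=
  (diagram lam).up_left_mem (by omega) (by omega) h

/-- The numbers in the square in the upper left corner of a tableau. -/
def cornerSquare (h : (1, 1) ∈ diagram lam) (T : Tableau lam) : Fin 4 ↪ Fin d where
  toFun j := T ⟨(j.val / 2, j.val % 2), square_mem_diagram h j⟩
  inj' i j hij := by
    have := T.injective hij
    rw [Subtype.mk.injEq, Prod.mk.injEq] at this
    apply Fin.ext
    omega

theorem cornerSquare_apply (h : (1, 1) ∈ diagram lam) (T : Tableau lam) (j : Fin 4) :
    cornerSquare h T j = T ⟨(j.val / 2, j.val % 2), square_mem_diagram h j⟩ := rfl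

theorem viaEmbeddingHom_mem_rowStabilizer (h : (1, 1) ∈ diagram lam) (T : Tableau lam)
    {r : Perm (Fin 4)} (hr : r ∈ squareRow) :
    viaEmbeddingHom (cornerSquare h T) r ∈ rowStabilizer T := by
  have key : ∀ r ∈ squareRow, ∀ j, (r j).val / 2 = j.val / 2 := by decide
  simp only [rowStabilizer, mem_filter, mem_univ, true_and]
  intro i
  rw [viaEmbeddingHom_apply]
  by_cases hi : i ∈ Set.range (cornerSquare h T)
  · obtain ⟨j, rfl⟩ := hi
    rw [viaEmbedding_apply]
    simpa [cornerSquare_apply] using key r hr j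
  · rw [viaEmbedding_apply_of_notMem _ _ _ hi]

theorem viaEmbeddingHom_mem_colStabilizer (h : (1, 1) ∈ diagram lam) (T : Tableau lam)
    {r : Perm (Fin 4)} (hr : r ∈ squareCol) :
    viaEmbeddingHom (cornerSquare h T) r ∈ colStabilizer T := by
  have key : ∀ r ∈ squareCol, ∀ j, (r j).val % 2 = j.val % 2 := by decide
  simp only [colStabilizer, mem_filter, mem_univ, true_and]
  intro i
  rw [viaEmbeddingHom_apply]
  by_cases hi : i ∈ Set.range (cornerSquare h T)
  · obtain ⟨j, rfl⟩ := hi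
    rw [viaEmbedding_apply]
    simpa [cornerSquare_apply] using key r hr j
  · rw [viaEmbedding_apply_of_notMem _ _ _ hi]

theorem sign_viaEmbeddingHom {α : Type*} [Fintype α] [DecidableEq α] (f : Fin 4 ↪ α)
    (σ : Perm (Fin 4)) : sign (viaEmbeddingHom f σ) = sign σ := by
  classical
  rw [viaEmbeddingHom_apply, viaEmbedding, sign_extendDomain]

open Classical in
-- The row and column sums absorb those of the corner square up to a factor `4` each. Since `K` is
-- central, it can be moved next to the square symmetrizer, which it kills.
theorem fullCycles_mul_youngSymmetrizer (h : (1, 1) ∈ diagram lam) (T : Tableau lam) :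
    (∑ σ : Perm (Fin d) with OneCycleOn univ σ, MonoidAlgebra.of ℚ (Perm (Fin d)) σ) *
      youngSymmetrizer T = 0 := by
  set K := ∑ σ : Perm (Fin d) with OneCycleOn univ σ, MonoidAlgebra.of ℚ (Perm (Fin d)) σ with hK
  have hcomm : ∀ τ : Perm (Fin d), K * MonoidAlgebra.of ℚ _ τ = MonoidAlgebra.of ℚ _ τ * K := by
    intro τ
    rw [hK, sum_mul, mul_sum]
    refine sum_bij' (fun σ _ => τ⁻¹ * σ * τ) (fun σ _ => τ * σ * τ⁻¹) ?_ ?_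
      (by simp [mul_assoc]) (by simp [mul_assoc]) ?_
    · intro σ hσ
      simp only [mem_filter, mem_univ, true_and] at hσ ⊢
      simpa using oneCycleOn_conj hσ τ⁻¹
    · intro σ hσ
      simp only [mem_filter, mem_univ, true_and] at hσ ⊢
      exact oneCycleOn_conj hσ τ
    · intro σ _
      rw [← map_mul, ← map_mul]
      simp [mul_assoc]
  set f := cornerSquare h T
  set a := ∑ p ∈ rowStabilizer T, MonoidAlgebra.of ℚ _ p with ha
  set b := ∑ q ∈ colStabilizer T, ((sign q : ℤ) : ℚ) • MonoidAlgebra.of ℚ _ q with hb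
  have h1 : a * ∑ r ∈ squareRow, MonoidAlgebra.of ℚ _ (viaEmbeddingHom f r) = (4 : ℚ) • a := by
    rw [mul_sum, sum_congr rfl fun r hr =>
      sum_rowStabilizer_mul_of (viaEmbeddingHom_mem_rowStabilizer h T hr), sum_const,
      show #squareRow = 4 from by decide, ← Nat.cast_smul_eq_nsmul ℚ, Nat.cast_ofNat]
  have h2 : (∑ k ∈ squareCol, ((sign k : ℤ) : ℚ) •
      MonoidAlgebra.of ℚ (Perm (Fin d)) (viaEmbeddingHom f k)) * b = (4 : ℚ) • b := by
    have : ∀ k ∈ squareCol, (((sign k : ℤ) : ℚ) •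
        MonoidAlgebra.of ℚ (Perm (Fin d)) (viaEmbeddingHom f k)) * b = b := by
      intro k hk
      rw [smul_mul_assoc, of_mul_sum_colStabilizer (viaEmbeddingHom_mem_colStabilizer h T hk),
        smul_smul, sign_viaEmbeddingHom, unit_mul_self, one_smul]
    rw [sum_mul, sum_congr rfl this, sum_const, show #squareCol = 4 from by decide,
      ← Nat.cast_smul_eq_nsmul ℚ, Nat.cast_ofNat]
  have h3 : K * a = a * K := by
    rw [ha, mul_sum, sum_mul]
    exact sum_congr rfl fun τ _ => hcomm τ
  have h4 : (4 : ℚ) • (4 : ℚ) • (K * (a * b)) = 0 := by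
    have h5 := fullCycles_mul_square f
    rw [← hK] at h5
    calc (4 : ℚ) • (4 : ℚ) • (K * (a * b)) = K * (((4 : ℚ) • a) * ((4 : ℚ) • b)) := by
          rw [smul_mul_smul_comm, smul_smul, mul_smul_comm]
      _ = a * (K * ((∑ r ∈ squareRow, MonoidAlgebra.of ℚ _ (viaEmbeddingHom f r)) *
          ∑ k ∈ squareCol, ((sign k : ℤ) : ℚ) • MonoidAlgebra.of ℚ _ (viaEmbeddingHom f k))) *
            b := by
          rw [← h1, ← h2, ← mul_assoc a, ← h3]
          simp only [mul_assoc]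
      _ = 0 := by rw [h5, mul_zero, zero_mul]
  change K * (a * b) = 0
  simpa using h4

open Classical in
/-- The character attached to a partition which is not a hook vanishes at the full cycles. -/
theorem chi_indiscrete_eq_zero (h : (1, 1) ∈ diagram lam) :
    chi lam (Nat.Partition.indiscrete d) = 0 := by
  have hd : 2 ≤ d := by
    have h1 := card_le_card_of_injOn (s := univ) (t := univ) (cornerSquare h (tableau lam))
      (by simp) (cornerSquare h (tableau lam)).injective.injOn
    simp at h1
    omega
  have hg := (exists_perm_of_partition (Nat.Partition.indiscrete d)).choose_spec
  rw [chi]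
  set g := (exists_perm_of_partition (Nat.Partition.indiscrete d)).choose
  rw [Nat.Partition.indiscrete_parts (by omega)] at hg
  obtain ⟨hg1, hg2⟩ := isCycle_of_parts_eq hd hg
  have hgK : OneCycleOn univ g := by
    have hmove : ∀ i, g i ≠ i := fun i => by
      rw [← mem_support, hg2]; exact mem_univ i
    exact fun i _ j _ => hg1.sameCycle (hmove i) (hmove j)
  have hsum := sum_character_spechtRep_eq_zero (lam := lam)
    ({σ | OneCycleOn univ σ} : Finset (Perm (Fin d)))
    (fun σ hσ τ => by
      simp only [mem_filter, mem_univ, true_and] at hσ ⊢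
      exact oneCycleOn_conj hσ τ) (fullCycles_mul_youngSymmetrizer h _)
  -- Full cycles form a single conjugacy class, so the vanishing sum is a nonzero multiple of one
  -- character value.
  have hconst : ∀ σ ∈ ({σ | OneCycleOn univ σ} : Finset (Perm (Fin d))),
      (spechtRep lam).character σ = (spechtRep lam).character g := by
    intro σ hσ
    simp only [mem_filter, mem_univ, true_and] at hσ
    obtain ⟨h1, h2⟩ := isCycle_of_oneCycleOn hd hσ
    obtain ⟨τ, hτ⟩ := isConj_iff.1 (hg1.isConj h1 (by rw [hg2, h2]))
    rw [← hτ, Representation.char_conj]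
  rw [sum_congr rfl hconst, sum_const, smul_eq_zero] at hsum
  refine hsum.resolve_left ?_
  rw [card_eq_zero]
  exact ne_empty_of_mem (a := g) (by simpa using hgK)

end NonHooks

end CompletedCycles

namespace CompletedCycles

open Finset

/-! ### Reduction to a sum over hooks. -/

section HookSum

variable {d : ℕ} {lam : d.Partition}

theorem parts_eq_map_rowLen :
    lam.parts = (Multiset.range (Multiset.card lam.parts)).map (diagram lam).rowLen := by
  have h : (diagram lam).rowLens = lam.parts.sort (· ≥ ·) :=
    YoungDiagram.rowLens_ofRowLens_eq_self
      fun x hx => lam.parts_pos ((Multiset.mem_sort _).1 hx)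
  rw [YoungDiagram.rowLens, colLen_diagram_zero] at h
  conv_lhs => rw [← Multiset.sort_eq lam.parts (· ≥ ·), ← h]
  rfl

theorem rowLen_eq_one (h : (1, 1) ∉ diagram lam) {i : ℕ} (hi : i + 1 < Multiset.card lam.parts) :
    (diagram lam).rowLen (i + 1) = 1 := by
  have h1 : (diagram lam).rowLen 1 ≤ 1 := by
    rwa [YoungDiagram.mem_iff_lt_rowLen, not_lt] at h
  have h2 := (diagram lam).rowLen_anti 1 (i + 1) (by omega)
  have h3 : 0 < (diagram lam).rowLen (i + 1) := by
    rwa [← YoungDiagram.mem_iff_lt_rowLen, YoungDiagram.mem_iff_lt_colLen, colLen_diagram_zero]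
  omega

theorem sum_rowLen : ∑ i ∈ range (Multiset.card lam.parts), (diagram lam).rowLen i = d := by
  conv_rhs => rw [← lam.parts_sum, parts_eq_map_rowLen]
  rfl

theorem rowLen_zero_add (h : (1, 1) ∉ diagram lam) {k : ℕ} (hk : Multiset.card lam.parts = k + 1) :
    (diagram lam).rowLen 0 + k = d := by
  have h1 := sum_rowLen (lam := lam)
  rw [hk, sum_range_succ', sum_congr rfl fun i hi =>
    rowLen_eq_one h (by rw [hk]; simpa using hi)] at h1
  simp at h1
  omega

theorem one_le_card_parts (hd : 0 < d) (lam : d.Partition) : 1 ≤ Multiset.card lam.parts := by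
  rw [Nat.one_le_iff_ne_zero, Ne, Multiset.card_eq_zero]
  intro h
  have := lam.parts_sum
  rw [h, Multiset.sum_zero] at this
  omega

theorem hook_eq_of_card_eq (hd : 0 < d) {mu : d.Partition} (h : (1, 1) ∉ diagram lam)
    (h' : (1, 1) ∉ diagram mu) (hc : Multiset.card lam.parts = Multiset.card mu.parts) :
    lam = mu := by
  obtain ⟨k, hk⟩ := Nat.exists_eq_add_of_le' (one_le_card_parts hd lam)
  ext1
  rw [parts_eq_map_rowLen (lam := lam), parts_eq_map_rowLen (lam := mu), ← hc]
  refine Multiset.map_congr rfl fun i hi => ?_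
  rw [Multiset.mem_range] at hi
  cases i with
  | zero =>
    have h1 := rowLen_zero_add h hk
    have h2 := rowLen_zero_add h' (hc ▸ hk)
    omega
  | succ i => rw [rowLen_eq_one h hi, rowLen_eq_one h' (hc ▸ hi)]

/-- The partition of `d` with one part `d - k` and `k` parts `1`. -/
def hookPartition (d : ℕ) (k : ℕ) (hk : k < d) : d.Partition where
  parts := (d - k) ::ₘ Multiset.replicate k 1
  parts_pos := by
    intro i hi
    rw [Multiset.mem_cons] at hi
    rcases hi with rfl | hi
    · omega
    · rw [Multiset.eq_of_mem_replicate hi]; exact one_pos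
  parts_sum := by
    rw [Multiset.sum_cons, Multiset.sum_replicate, smul_eq_mul, mul_one]
    omega

theorem card_hookPartition {k : ℕ} (hk : k < d) :
    Multiset.card (hookPartition d k hk).parts = k + 1 := by
  simp [hookPartition]

theorem notMem_diagram_hookPartition {k : ℕ} (hk : k < d) :
    (1, 1) ∉ diagram (hookPartition d k hk) := by
  have hsort : (hookPartition d k hk).parts.sort (· ≥ ·) =
      (d - k) :: (Multiset.replicate k 1).sort (· ≥ ·) := by
    refine Multiset.sort_cons (d - k) (Multiset.replicate k 1) (· ≥ ·) fun b hb => ?_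
    rw [Multiset.eq_of_mem_replicate hb]
    omega
  rw [diagram, YoungDiagram.mem_ofRowLens]
  rintro ⟨h1, h2⟩
  simp only [hsort, List.getElem_cons_succ] at h2
  have h3 : ((Multiset.replicate k 1).sort (· ≥ ·))[0]'(by
      simp only [hsort, List.length_cons] at h1; omega) = 1 :=
    Multiset.eq_of_mem_replicate ((Multiset.mem_sort (· ≥ ·)).1 (List.getElem_mem _))
  omega

/-- A sum over all partitions of `d` with nonzero terms for hooks only. -/
theorem sum_partition_eq_sum_hook (hd : 0 < d) (F : d.Partition → ℚ) (G : ℕ → ℚ)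
    (h0 : ∀ lam, (1, 1) ∈ diagram lam → F lam = 0)
    (hG : ∀ lam, (1, 1) ∉ diagram lam → F lam = G (Multiset.card lam.parts - 1)) :
    ∑ lam, F lam = ∑ k ∈ range d, G k := by
  classical
  rw [← sum_filter_of_ne (p := fun lam => (1, 1) ∉ diagram lam)
    (fun lam _ hne hmem => hne (h0 lam hmem))]
  refine sum_bij (fun lam _ => Multiset.card lam.parts - 1) ?_ ?_ ?_ ?_
  · intro lam hlam
    have h := (mem_filter.1 hlam).2
    obtain ⟨k, hk⟩ := Nat.exists_eq_add_of_le' (one_le_card_parts hd lam)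
    have h1 := rowLen_zero_add h hk
    have h2 : 0 < (diagram lam).rowLen 0 :=
      YoungDiagram.mem_iff_lt_rowLen.1 (zero_mem_diagram hd)
    rw [mem_range]
    omega
  · intro lam hlam mu hmu hc
    have h1 := one_le_card_parts hd lam
    have h2 := one_le_card_parts hd mu
    exact hook_eq_of_card_eq hd (mem_filter.1 hlam).2 (mem_filter.1 hmu).2 (by omega)
  · intro k hk
    rw [mem_range] at hk
    refine ⟨hookPartition d k hk, mem_filter.2 ⟨mem_univ _, notMem_diagram_hookPartition hk⟩, ?_⟩
    rw [card_hookPartition, Nat.add_sub_cancel]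
  · intro lam hlam
    exact hG lam (mem_filter.1 hlam).2

/-- All rows below the first have length `1`, so their contributions telescope. -/
theorem shiftedPowerSum_three_hook (h : (1, 1) ∉ diagram lam) {k : ℕ}
    (hk : Multiset.card lam.parts = k + 1) :
    shiftedPowerSum 3 lam / 6 = (d : ℚ) ^ 3 / 24 + d / 2 * (((d : ℚ) - 1) / 2 - k) ^ 2 := by
  have h1 := rowLen_zero_add h hk
  have h2 : ∀ i ∈ range k, ((((diagram lam).rowLen (i + 1) : ℕ) : ℚ) - (((i + 1 : ℕ) : ℚ) + 1) +
      1 / 2) ^ 3 - (-(((i + 1 : ℕ) : ℚ) + 1) + 1 / 2) ^ 3 =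
      ((((i + 1 : ℕ) : ℚ) + 1 / 2) ^ 3 - ((i : ℚ) + 1 / 2) ^ 3) := by
    intro i hi
    rw [rowLen_eq_one h (by rw [hk]; simpa using hi)]
    push_cast
    ring
  rw [shiftedPowerSum, hk, sum_range_succ', sum_congr rfl h2,
    sum_range_sub (fun i : ℕ => ((i : ℚ) + 1 / 2) ^ 3)]
  have h3 : (d : ℚ) = ((diagram lam).rowLen 0 : ℚ) + k := by exact_mod_cast h1.symm
  rw [h3]
  push_cast
  ring

open Polynomial

/-- Substituting `-X` for `X` isolates a sign that cancels in the product of two hook characters. -/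
theorem chi_hook_eq_neg_one_pow (hd : 0 < d) (h : (1, 1) ∉ diagram lam) (mu : d.Partition)
    {Y : ℚ[X]} (hY : (1 - X) * Y = (mu.parts.map fun c => 1 - X ^ c).prod) :
    chi lam mu = (-1) ^ (Multiset.card lam.parts - 1) * Y.coeff (Multiset.card lam.parts - 1) := by
  rw [chi_hook hd h mu (Y := Y.comp (-X))]
  · rw [show (-X : ℚ[X]) = C (-1) * X by simp, comp_C_mul_X_coeff, mul_comm]
  · have h1 := congrArg (fun p : ℚ[X] => p.comp (-X)) hY
    simp only [mul_comp, sub_comp, one_comp, X_comp, sub_neg_eq_add] at h1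
    rw [h1, multiset_prod_comp, Multiset.map_map]
    simp [sub_comp]

/-- The sum over all partitions in the definition of one-part double Hurwitz numbers is a sum over
hooks. -/
theorem sum_chi_indiscrete (hd : 0 < d) (mu : d.Partition) (s : ℕ)
    {Y : ℚ[X]} (hY : (1 - X) * Y = (mu.parts.map fun c => 1 - X ^ c).prod) :
    ∑ lam : d.Partition, chi lam (Nat.Partition.indiscrete d) * (shiftedPowerSum 3 lam / 6) ^ s *
      chi lam mu =
    ∑ k ∈ range d, ((d : ℚ) ^ 3 / 24 + d / 2 * (((d : ℚ) - 1) / 2 - k) ^ 2) ^ s * Y.coeff k := by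
  refine sum_partition_eq_sum_hook hd _ _ ?_ ?_
  · intro lam h
    rw [chi_indiscrete_eq_zero h, zero_mul, zero_mul]
  · intro lam h
    obtain ⟨k, hk⟩ := Nat.exists_eq_add_of_le' (one_le_card_parts hd lam)
    have hkd : k < d := by
      have h1 := rowLen_zero_add h hk
      have h2 : 0 < (diagram lam).rowLen 0 :=
        YoungDiagram.mem_iff_lt_rowLen.1 (zero_mem_diagram hd)
      omega
    -- For the single part `d` the quotient is a geometric sum with all coefficients `1`, so the
    -- character is just the sign.
    have hgeom : (1 - X) * (∑ i ∈ range d, (X : ℚ[X]) ^ i) =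
        ((Nat.Partition.indiscrete d).parts.map fun c => 1 - (X : ℚ[X]) ^ c).prod := by
      rw [Nat.Partition.indiscrete_parts hd.ne', Multiset.map_singleton, Multiset.prod_singleton,
        mul_neg_geom_sum]
    rw [chi_hook_eq_neg_one_pow hd h _ hgeom, chi_hook_eq_neg_one_pow hd h mu hY,
      shiftedPowerSum_three_hook h hk, hk, Nat.add_sub_cancel, finsetSum_coeff]
    simp only [coeff_X_pow]
    rw [sum_ite_eq, if_pos (mem_range.2 hkd), mul_one]
    have h1 : ((-1 : ℚ) ^ k) * (-1) ^ k = 1 := by rw [← mul_pow]; simp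
    linear_combination ((d : ℚ) ^ 3 / 24 + d / 2 * (((d : ℚ) - 1) / 2 - k) ^ 2) ^ s *
      Y.coeff k * h1

end HookSum

end CompletedCycles

namespace CompletedCycles

open Finset

/-! ### Hyperbolic sine series, moments and Bernoulli numbers. -/

section Series

open PowerSeries

/-- The power series `exp (t z)`. -/
noncomputable def expSeries (t : ℚ) : ℚ⟦X⟧ := rescale t (exp ℚ)

theorem expSeries_mul (a b : ℚ) : expSeries a * expSeries b = expSeries (a + b) :=
  exp_mul_exp_eq_exp_add a b

theorem expSeries_zero : expSeries 0 = 1 := by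
  rw [expSeries, rescale_zero]
  simp

theorem expSeries_pow (t : ℚ) (k : ℕ) : expSeries t ^ k = expSeries (k * t) := by
  induction k with
  | zero => simp [expSeries_zero]
  | succ k ih =>
    rw [pow_succ, ih, expSeries_mul]
    congr 1
    push_cast
    ring

theorem expSeries_sum {ι : Type*} (s : Finset ι) (f : ι → ℚ) :
    expSeries (∑ i ∈ s, f i) = ∏ i ∈ s, expSeries (f i) := by
  classical
  induction s using Finset.induction_on with
  | empty => simp [expSeries_zero]
  | insert a s ha ih => rw [sum_insert ha, prod_insert ha, ← ih, expSeries_mul]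

theorem coeff_expSeries (t : ℚ) (m : ℕ) : coeff m (expSeries t) = t ^ m / m.factorial := by
  rw [expSeries, coeff_rescale, coeff_exp]
  simp [div_eq_mul_inv]

theorem rescale_expSeries (a t : ℚ) : rescale a (expSeries t) = expSeries (t * a) := by
  rw [expSeries, rescale_rescale, expSeries]

/-- The power series of `2 sinh (z / 2) = exp (z / 2) - exp (- z / 2)`. -/
noncomputable def sinhSeries : ℚ⟦X⟧ := expSeries (1 / 2) - expSeries (-1 / 2)

/-- The power series of `2 sinh (z / 2) / z`. -/
noncomputable def sinhcSeries : ℚ⟦X⟧ := mk fun m => coeff (m + 1) sinhSeries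

/-- The power series of `z / (2 sinh (z / 2))`. -/
noncomputable def invSinhcSeries : ℚ⟦X⟧ :=
  2 * rescale (1 / 2) (bernoulliPowerSeries ℚ) - bernoulliPowerSeries ℚ

theorem X_mul_sinhcSeries : X * sinhcSeries = sinhSeries := by
  ext m
  cases m with
  | zero => rw [coeff_zero_X_mul, sinhSeries, map_sub, coeff_expSeries, coeff_expSeries]; simp
  | succ m => rw [coeff_succ_X_mul, sinhcSeries, coeff_mk]

theorem constantCoeff_sinhcSeries : constantCoeff sinhcSeries = 1 := by
  rw [← coeff_zero_eq_constantCoeff_apply, sinhcSeries, coeff_mk, sinhSeries, map_sub,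
    coeff_expSeries, coeff_expSeries]
  norm_num

/-- With `u = exp (z/2)`, `z / (u - u⁻¹) = z / (u - 1) - z / (u^2 - 1)`, and both terms on the right
are Bernoulli series. -/
theorem sinhcSeries_mul_invSinhcSeries : sinhcSeries * invSinhcSeries = 1 := by
  refine X_mul_cancel ?_
  rw [← mul_assoc, X_mul_sinhcSeries, mul_one, sinhSeries, invSinhcSeries]
  have h1 : expSeries (1 / 2) * expSeries (-1 / 2) = 1 := by
    rw [expSeries_mul, ← expSeries_zero]; norm_num
  have h2 : bernoulliPowerSeries ℚ * (expSeries (1 / 2) * expSeries (1 / 2) - 1) = X := by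
    rw [expSeries_mul, ← bernoulliPowerSeries_mul_exp_sub_one ℚ, expSeries]
    norm_num
  have h3 : 2 * rescale (1 / 2) (bernoulliPowerSeries ℚ) * (expSeries (1 / 2) - 1) = X := by
    have h := congrArg (rescale (1 / 2 : ℚ)) (bernoulliPowerSeries_mul_exp_sub_one ℚ)
    rw [map_mul, map_sub, map_one, rescale_X, ← expSeries] at h
    rw [mul_assoc, h, ← mul_assoc, ← map_ofNat (C : ℚ →+* ℚ⟦X⟧) 2, ← map_mul]
    norm_num
  linear_combination -expSeries (1 / 2) * (2 * rescale (1 / 2) (bernoulliPowerSeries ℚ) -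
    bernoulliPowerSeries ℚ) * h1 + expSeries (-1 / 2) * (expSeries (1 / 2) + 1) * h3 -
    expSeries (-1 / 2) * h2 + X * h1

theorem coeff_invSinhcSeries (m : ℕ) :
    coeff m invSinhcSeries = (2 * (1 / 2) ^ m - 1) * (bernoulli m / m.factorial) := by
  rw [invSinhcSeries, map_sub, ← map_ofNat (C : ℚ →+* ℚ⟦X⟧) 2, coeff_C_mul, coeff_rescale,
    bernoulliPowerSeries, coeff_mk]
  simp
  ring

/-- The generating function of the moments of the hook characters. -/
theorem sum_coeff_mul_expSeries {n : ℕ} (β : Fin n → ℕ) (hd : 0 < ∑ i, β i) {Y : Polynomial ℚ}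
    (hY : (1 - Polynomial.X) * Y = ∏ i, (1 - Polynomial.X ^ β i)) :
    (∑ k ∈ range (∑ i, β i), C (Y.coeff k) *
      expSeries ((((∑ i, β i : ℕ) : ℚ) - 1) / 2 - k)) * sinhSeries =
      ∏ i, rescale (β i : ℚ) sinhSeries := by
  set d := ∑ i, β i with hdef
  have hdeg : Y.natDegree < d := by
    by_cases hY0 : Y = 0
    · simpa [hY0] using hd
    have h1 : (1 - Polynomial.X : Polynomial ℚ).natDegree = 1 := by
      rw [← Polynomial.natDegree_neg, neg_sub, ← Polynomial.C_1, Polynomial.natDegree_X_sub_C]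
    have h2 : (1 - Polynomial.X : Polynomial ℚ) ≠ 0 := by
      intro h0; rw [h0] at h1; simp at h1
    have h3 := congrArg Polynomial.natDegree hY
    rw [Polynomial.natDegree_mul h2 hY0, h1] at h3
    have h4 : (∏ i, (1 - Polynomial.X ^ β i : Polynomial ℚ)).natDegree ≤ d := by
      refine (Polynomial.natDegree_prod_le _ _).trans (sum_le_sum fun i _ => ?_)
      refine (Polynomial.natDegree_sub_le _ _).trans ?_
      simp
    omega
  -- Put `X = exp (-z)`; multiplying by `exp (d z / 2)` then symmetrizes each factor into a
  -- hyperbolic sine.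
  have h1 := congrArg (Polynomial.aeval (expSeries (-1))) hY
  rw [map_mul, map_prod, Polynomial.aeval_eq_sum_range' hdeg] at h1
  simp only [map_sub, map_one, Polynomial.aeval_X, map_pow, expSeries_pow] at h1
  have h2 : expSeries ((d : ℚ) / 2) = ∏ i, expSeries ((β i : ℚ) / 2) := by
    rw [← expSeries_sum, ← sum_div, hdef]
    push_cast
    rfl
  have h3 : ∀ i, rescale (β i : ℚ) sinhSeries =
      expSeries ((β i : ℚ) / 2) * (1 - expSeries (β i * -1)) := by
    intro i
    rw [sinhSeries, map_sub, rescale_expSeries, rescale_expSeries, mul_sub, mul_one, expSeries_mul]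
    congr 2 <;> ring
  have h4 : sinhSeries = expSeries (1 / 2) * (1 - expSeries (-1)) := by
    rw [sinhSeries, mul_sub, mul_one, expSeries_mul]
    norm_num
  simp only [h3]
  rw [prod_mul_distrib, ← h2, ← h1, h4, mul_sum, mul_sum, sum_mul]
  refine sum_congr rfl fun k _ => ?_
  have h5 : expSeries (((d : ℚ) - 1) / 2 - k) * expSeries (1 / 2) =
      expSeries ((d : ℚ) / 2) * expSeries (k * -1) := by
    rw [expSeries_mul, expSeries_mul]
    congr 1
    ring
  rw [smul_eq_C_mul]
  linear_combination C (Y.coeff k) * (1 - expSeries (-1)) * h5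

/-- Each `2 sinh (β z / 2)` is `β z S(β z)`, and the denominator removes one of the `n + 1` powers
of `z`. -/
theorem sum_coeff_mul_expSeries_eq {n : ℕ} (β : Fin (n + 1) → ℕ) (hd : 0 < ∑ i, β i)
    {Y : Polynomial ℚ} (hY : (1 - Polynomial.X) * Y = ∏ i, (1 - Polynomial.X ^ β i)) :
    (∑ k ∈ range (∑ i, β i), C (Y.coeff k) *
      expSeries ((((∑ i, β i : ℕ) : ℚ) - 1) / 2 - k)) =
      C (∏ i, (β i : ℚ)) * (X ^ n *
        ((∏ i, rescale (β i : ℚ) sinhcSeries) * invSinhcSeries)) := by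
  have h := sum_coeff_mul_expSeries β hd hY
  have h1 : ∀ i, rescale (β i : ℚ) sinhSeries = C (β i : ℚ) * X * rescale (β i : ℚ) sinhcSeries := by
    intro i
    rw [← X_mul_sinhcSeries, map_mul, rescale_X]
  simp only [h1] at h
  rw [prod_mul_distrib, prod_mul_distrib, prod_const, card_univ, Fintype.card_fin, pow_succ,
    ← map_prod, ← X_mul_sinhcSeries] at h
  refine X_mul_cancel ?_
  linear_combination invSinhcSeries * h - X * (∑ k ∈ range (∑ i, β i), C (Y.coeff k) *
      expSeries ((((∑ i, β i : ℕ) : ℚ) - 1) / 2 - k)) * sinhcSeries_mul_invSinhcSeries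

/-- The moments of the hook characters. -/
theorem sum_pow_mul_coeff {n : ℕ} (β : Fin (n + 1) → ℕ) (hd : 0 < ∑ i, β i)
    {Y : Polynomial ℚ} (hY : (1 - Polynomial.X) * Y = ∏ i, (1 - Polynomial.X ^ β i)) (m : ℕ) :
    ∑ k ∈ range (∑ i, β i), ((((∑ i, β i : ℕ) : ℚ) - 1) / 2 - k) ^ m * Y.coeff k =
      (∏ i, (β i : ℚ)) * (m.factorial * if n ≤ m then
        coeff (m - n) ((∏ i, rescale (β i : ℚ) sinhcSeries) * invSinhcSeries) else 0) := by
  have h := congrArg (coeff m) (sum_coeff_mul_expSeries_eq β hd hY)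
  rw [map_sum, coeff_C_mul, coeff_X_pow_mul'] at h
  simp only [coeff_C_mul, coeff_expSeries] at h
  have hm : (m.factorial : ℚ) ≠ 0 := by exact_mod_cast m.factorial_ne_zero
  rw [mul_left_comm, ← h, mul_sum]
  refine sum_congr rfl fun k _ => ?_
  field_simp

/-- Euler's formula expresses the series `ζ(2g)`, whose terms are nonnegative, as a positive
multiple of this number. -/
theorem neg_one_pow_mul_bernoulli_nonneg {g : ℕ} (hg : g ≠ 0) :
    0 ≤ (-1 : ℚ) ^ (g + 1) * bernoulli (2 * g) := by
  have h := (hasSum_zeta_nat hg).nonneg (fun n => by positivity)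
  have h1 : (0 : ℝ) ≤ (2 ^ (2 * g - 1) * Real.pi ^ (2 * g) / (2 * g).factorial) *
      (((-1 : ℚ) ^ (g + 1) * bernoulli (2 * g) : ℚ) : ℝ) := by
    refine h.trans_eq ?_
    push_cast
    ring
  have h2 : (0 : ℝ) < 2 ^ (2 * g - 1) * Real.pi ^ (2 * g) / (2 * g).factorial := by
    have := Real.pi_pos
    positivity
  exact_mod_cast nonneg_of_mul_nonneg_right h1 h2

/-- For `g ≥ 1` the signs of `2^{1-2g} - 1` and `B_{2g}` combine to `(-1)^g`. For `g = 0` the factor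
`2^{-1} - 1` is negative, which is why its absolute value is taken. -/
theorem neg_one_pow_mul_coeff_invSinhcSeries (g : ℕ) :
    (-1) ^ g * coeff (2 * g) invSinhcSeries =
      |(2 : ℚ) ^ (2 * (g : ℤ) - 1) - 1| * |bernoulli (2 * g)| /
        ((2 * g).factorial * (2 : ℚ) ^ (2 * (g : ℤ) - 1)) := by
  rw [coeff_invSinhcSeries]
  have hf : ((2 * g).factorial : ℚ) ≠ 0 := by exact_mod_cast (2 * g).factorial_ne_zero
  rcases Nat.eq_zero_or_pos g with rfl | hg
  · norm_num
  · have hb := neg_one_pow_mul_bernoulli_nonneg hg.ne'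
    have habs : |bernoulli (2 * g)| = (-1 : ℚ) ^ (g + 1) * bernoulli (2 * g) := by
      rw [← abs_of_nonneg hb, abs_mul, abs_pow, abs_neg, abs_one, one_pow, one_mul]
    obtain ⟨m, rfl⟩ := Nat.exists_eq_add_of_lt hg
    have hz : (2 : ℚ) ^ (2 * ((0 + m + 1 : ℕ) : ℤ) - 1) = 2 ^ (2 * m + 1) := by
      rw [← zpow_natCast]
      congr 1
      push_cast
      ring
    have h1 : (1 : ℚ) ≤ 2 ^ (2 * m + 1) := one_le_pow₀ (by norm_num)
    rw [hz, habs, abs_of_nonneg (by linarith), one_div_pow]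
    have h2 : (2 : ℚ) ^ (2 * (0 + m + 1)) = 2 * 2 ^ (2 * m + 1) := by ring
    rw [h2]
    field_simp
    ring

end Series

/-! ### The Hurwitz polynomial and its lowest-degree coefficients. -/

section Polynomial

open MvPolynomial

/-- The coefficients of `∏ S(X_i z) / S(z)`, where `S(z) = 2 sinh (z / 2) / z`. -/
noncomputable def momentPoly (n m : ℕ) : MvPolynomial (Fin n) ℚ :=
  PowerSeries.coeff m ((∏ i, PowerSeries.rescale (X i) (PowerSeries.map C sinhcSeries)) *
    PowerSeries.map C invSinhcSeries)

theorem eval_momentPoly {n : ℕ} (m : ℕ) (x : Fin n → ℚ) :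
    eval x (momentPoly n m) = PowerSeries.coeff m
      ((∏ i, PowerSeries.rescale (x i) sinhcSeries) * invSinhcSeries) := by
  have h : ∀ f : PowerSeries ℚ, PowerSeries.map (eval x) (PowerSeries.map C f) = f := by
    intro f
    ext k
    simp
  rw [momentPoly, ← PowerSeries.coeff_map, map_mul, map_prod, h]
  simp only [← PowerSeries.rescale_map, eval_X, h]

theorem constantCoeff_momentPoly (n m : ℕ) :
    constantCoeff (momentPoly n m) = PowerSeries.coeff m invSinhcSeries := by
  rw [← eval_zero', eval_momentPoly]
  simp [PowerSeries.rescale_zero, constantCoeff_sinhcSeries]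

/-- `φ` already uses up degree `m`, so only the constant term of `ψ` can contribute. -/
theorem coeff_mul_of_isHomogeneous {σ R : Type*} [CommSemiring R] {φ ψ : MvPolynomial σ R}
    {m : ℕ} (hφ : φ.IsHomogeneous m) (b : σ →₀ ℕ) (hb : b.degree ≤ m) :
    coeff b (φ * ψ) = coeff b φ * constantCoeff ψ := by
  classical
  rw [coeff_mul, sum_eq_single (b, 0)]
  · rfl
  · rintro ⟨p, q⟩ hpq hne
    rw [HasAntidiagonal.mem_antidiagonal] at hpq
    simp only at hpq
    rw [hφ.coeff_eq_zero, zero_mul]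
    intro hp
    simp only at hp
    have h1 : p.degree + q.degree = b.degree := by rw [← hpq, map_add]
    have h2 : q = 0 := (Finsupp.degree_eq_zero_iff q).1 (by omega)
    subst h2
    rw [add_zero] at hpq
    exact hne (by rw [hpq])
  · intro h
    simp at h

/-- The polynomial `d H / s!` for one-part double Hurwitz numbers. -/
noncomputable def hurwitzPoly (g n : ℕ) : MvPolynomial (Fin n) ℚ :=
  ∑ j ∈ range (g + (n - 1) / 2 + 1),
    C (((g + (n - 1) / 2).choose j : ℚ) * (1 / 24) ^ (g + (n - 1) / 2 - j) * (1 / 2) ^ j *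
      (2 * j).factorial / (g + (n - 1) / 2).factorial) *
    ((∑ i, X i) ^ (3 * (g + (n - 1) / 2 - j) + j) *
      if n - 1 ≤ 2 * j then momentPoly n (2 * j - (n - 1)) else 0)

theorem parts_partitionOf {n : ℕ} {β : Fin n → ℕ} (hβ : ∀ i, 0 < β i) :
    (partitionOf β).parts = univ.val.map β := by
  refine (Nat.Partition.ofSums_parts _ _ _).trans (Multiset.filter_eq_self.2 ?_)
  intro a ha
  obtain ⟨i, -, rfl⟩ := Multiset.mem_map.1 ha
  exact (hβ i).ne'

theorem onePartHurwitz_eq {g n : ℕ} (hn : Odd n) {β : Fin n → ℕ} (hβ : ∀ i, 0 < β i)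
    (hd : 0 < ∑ i, β i) {Y : Polynomial ℚ}
    (hY : (1 - Polynomial.X) * Y = ∏ i, (1 - Polynomial.X ^ β i)) :
    onePartHurwitz g β = 1 / (((∑ i, β i : ℕ) : ℚ) * ∏ i, (β i : ℚ)) *
      ∑ k ∈ range (∑ i, β i), (((∑ i, β i : ℕ) : ℚ) ^ 3 / 24 + ((∑ i, β i : ℕ) : ℚ) / 2 *
        ((((∑ i, β i : ℕ) : ℚ) - 1) / 2 - k) ^ 2) ^ (g + (n - 1) / 2) * Y.coeff k := by
  -- Oddness of `n` makes `2g - 2 + 1 + n` even, so the natural-number division is exact.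
  have hexp : (2 * g + Multiset.card (Nat.Partition.indiscrete (∑ i, β i)).parts +
      Multiset.card (partitionOf β).parts - 2) / 2 = g + (n - 1) / 2 := by
    rw [Nat.Partition.indiscrete_parts hd.ne', parts_partitionOf hβ]
    obtain ⟨m, rfl⟩ := hn
    simp
    omega
  have hfac : (((2 + 1).factorial : ℕ) : ℚ) = 6 := by norm_num [Nat.factorial]
  have hY' : (1 - Polynomial.X) * Y =
      ((partitionOf β).parts.map fun c => 1 - (Polynomial.X : Polynomial ℚ) ^ c).prod := by
    rw [hY, parts_partitionOf hβ, Multiset.map_map]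
    rfl
  rw [onePartHurwitz, hurwitz, hexp, hfac, sum_chi_indiscrete hd _ _ hY',
    Nat.Partition.indiscrete_parts hd.ne', parts_partitionOf hβ, Multiset.prod_singleton]
  congr 3
  rw [← Finset.prod_eq_multiset_prod, Nat.cast_prod]

theorem isHurwitzPolynomial_hurwitzPoly {g n : ℕ} (hn : Odd n) :
    IsHurwitzPolynomial g n (hurwitzPoly g n) := by
  intro β hβ
  obtain ⟨n, rfl⟩ : ∃ m, n = m + 1 := Nat.exists_eq_add_of_le' hn.pos
  have hd : 0 < ∑ i, β i := sum_pos (fun i _ => hβ i) univ_nonempty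
  obtain ⟨Y, hY⟩ : (1 - Polynomial.X : Polynomial ℚ) ∣ ∏ i, (1 - Polynomial.X ^ β i) := by
    refine dvd_trans ?_ (dvd_prod_of_mem _ (mem_univ 0))
    simpa using sub_dvd_pow_sub_pow (1 : Polynomial ℚ) Polynomial.X (β 0)
  rw [onePartHurwitz_eq hn hβ hd hY.symm, hurwitzPoly]
  set s := g + (n + 1 - 1) / 2
  set d := ∑ i, β i with hddef
  have hd0 : (d : ℚ) ≠ 0 := by exact_mod_cast hd.ne'
  have hb0 : (∏ i, (β i : ℚ)) ≠ 0 := prod_ne_zero_iff.2 fun i _ => by exact_mod_cast (hβ i).ne'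
  have hs0 : (s.factorial : ℚ) ≠ 0 := by exact_mod_cast s.factorial_ne_zero
  -- Binomial expansion reduces everything to the even moments.
  have hsum : ∑ k ∈ range d, ((d : ℚ) ^ 3 / 24 + (d : ℚ) / 2 * (((d : ℚ) - 1) / 2 - k) ^ 2) ^ s *
      Y.coeff k = ∑ j ∈ range (s + 1), (s.choose j : ℚ) * ((d : ℚ) ^ 3 / 24) ^ (s - j) *
        ((d : ℚ) / 2) ^ j * ∑ k ∈ range d, (((d : ℚ) - 1) / 2 - k) ^ (2 * j) * Y.coeff k := by
    simp only [mul_sum]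
    rw [sum_comm]
    refine sum_congr rfl fun k _ => ?_
    rw [add_comm, add_pow, sum_mul]
    refine sum_congr rfl fun j _ => ?_
    rw [mul_pow, ← pow_mul]
    ring
  rw [hsum, map_sum, mul_sum, mul_sum, sum_div]
  refine sum_congr rfl fun j _ => ?_
  rw [sum_pow_mul_coeff β hd hY.symm, map_mul, map_mul, map_pow, map_sum, eval_C]
  simp only [eval_X]
  have hd' : ∑ i, (β i : ℚ) = d := by rw [hddef]; push_cast; rfl
  have hif : eval (fun i => (β i : ℚ)) (if n + 1 - 1 ≤ 2 * j then
      momentPoly (n + 1) (2 * j - (n + 1 - 1)) else 0) = if n ≤ 2 * j then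
        PowerSeries.coeff (2 * j - n) ((∏ i, PowerSeries.rescale (β i : ℚ) sinhcSeries) *
          invSinhcSeries) else 0 := by
    rw [Nat.add_sub_cancel]
    split_ifs with h
    · rw [eval_momentPoly]
    · simp
  rw [hif, hd', pow_add, pow_mul]
  generalize (if n ≤ 2 * j then PowerSeries.coeff (2 * j - n)
    ((∏ i, PowerSeries.rescale (β i : ℚ) sinhcSeries) * invSinhcSeries) else 0) = t
  rw [one_div_pow, one_div_pow, div_pow, div_pow]
  field_simp

/-- Two polynomials that agree on a product of infinite sets coincide. -/
theorem IsHurwitzPolynomial.unique {g n : ℕ} {P Q : MvPolynomial (Fin n) ℚ}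
    (hP : IsHurwitzPolynomial g n P) (hQ : IsHurwitzPolynomial g n Q) : P = Q := by
  refine MvPolynomial.funext_set (fun _ => (fun k : ℕ => ((k + 1 : ℕ) : ℚ)) '' Set.univ) ?_ ?_
  · intro i
    refine Set.infinite_univ.image (Function.Injective.injOn ?_)
    intro a b hab
    simpa using hab
  · intro x hx
    have h1 : ∀ i, ∃ k : ℕ, ((k + 1 : ℕ) : ℚ) = x i := by
      intro i
      obtain ⟨k, -, hk⟩ := hx i (Set.mem_univ i)
      exact ⟨k, hk⟩
    choose k hk using h1
    have h2 : x = fun i => ((k i + 1 : ℕ) : ℚ) := funext fun i => (hk i).symm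
    rw [h2, hP (fun i => k i + 1) (fun i => Nat.succ_pos _),
      hQ (fun i => k i + 1) (fun i => Nat.succ_pos _)]

/-- The term `j` has the factor `(∑ X_i)^{3s-2j}`, of degree above `s` unless `j = s`. In that term
`(∑ X_i)^s` gives the multinomial coefficient, and `2s - (n - 1) = 2g` selects the coefficient of
`1/S`. -/
theorem coeff_hurwitzPoly {g n : ℕ} (hn : Odd n) {b : Fin n → ℕ}
    (hb : ∑ i, b i = g + (n - 1) / 2) :
    coeff (Finsupp.equivFunOnFinite.symm b) (hurwitzPoly g n) =
      (1 / 2) ^ (g + (n - 1) / 2) * (2 * g + n - 1).factorial / (g + (n - 1) / 2).factorial *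
        (Nat.multinomial univ b * PowerSeries.coeff (2 * g) invSinhcSeries) := by
  have hhom : ∀ m, ((∑ i : Fin n, X i : MvPolynomial (Fin n) ℚ) ^ m).IsHomogeneous m := by
    intro m
    have h1 : (∑ i : Fin n, X i : MvPolynomial (Fin n) ℚ).IsHomogeneous 1 :=
      IsHomogeneous.sum _ _ _ fun i _ => isHomogeneous_X ℚ i
    simpa using h1.pow m
  have hdeg : (Finsupp.equivFunOnFinite.symm b).degree = g + (n - 1) / 2 := by
    rw [Finsupp.degree_eq_sum, ← hb]
    rfl
  have hmult : (Finsupp.equivFunOnFinite.symm b).multinomial = Nat.multinomial univ b := by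
    rw [Finsupp.multinomial, Nat.multinomial, Finsupp.sum_fintype _ _ (fun _ => rfl),
      Finsupp.prod_fintype _ _ (fun _ => rfl)]
    rfl
  set s := g + (n - 1) / 2 with hs
  have hsum : ((Finsupp.equivFunOnFinite.symm b).sum fun _ m => m) =
      3 * (s - s) + s := by
    rw [Finsupp.sum_fintype _ _ (fun _ => rfl), Nat.sub_self, mul_zero, zero_add, ← hb]
    rfl
  have h2s : 2 * s = 2 * g + n - 1 := by
    obtain ⟨m, rfl⟩ := hn
    omega
  have hn1 := hn.pos
  rw [hurwitzPoly, coeff_sum, ← hs, sum_eq_single s]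
  · rw [coeff_C_mul, coeff_mul_of_isHomogeneous (hhom _) _ (by rw [hdeg]; omega),
      coeff_sum_X_pow_of_fintype, if_pos hsum, if_pos (by omega), constantCoeff_momentPoly, hmult,
      show 2 * s - (n - 1) = 2 * g by omega, h2s, Nat.choose_self, Nat.sub_self, pow_zero, mul_one,
      Nat.cast_one, one_mul]
  · intro j hj hjs
    have hj' : j < s := by
      have := mem_range.1 hj
      omega
    rw [coeff_C_mul, coeff_mul_of_isHomogeneous (hhom _) _ (by rw [hdeg]; omega),
      (hhom _).coeff_eq_zero (by rw [hdeg]; omega), zero_mul, mul_zero]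
  · intro h
    exact absurd (mem_range.2 (Nat.lt_succ_self s)) h

end Polynomial

end CompletedCycles

theorem proposition4p2 (g n : ℕ) (hn : Odd n) :
    (∃! P : MvPolynomial (Fin n) ℚ, CompletedCycles.IsHurwitzPolynomial g n P) ∧
      ∀ b : Fin n → ℕ, ∑ i, b i = g + (n - 1) / 2 →
        CompletedCycles.hodgeIntegral g g b =
          (Nat.multinomial Finset.univ b : ℚ) * CompletedCycles.hodgeConstant g n := by
  have hP := CompletedCycles.isHurwitzPolynomial_hurwitzPoly (g := g) hn
  refine ⟨⟨_, hP, fun Q hQ => hQ.unique hP⟩, fun b hb => ?_⟩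
  have hex : ∃ P : MvPolynomial (Fin n) ℚ, CompletedCycles.IsHurwitzPolynomial g n P := ⟨_, hP⟩
  rw [CompletedCycles.hodgeIntegral, dif_pos hex, hex.choose_spec.unique hP,
    CompletedCycles.coeff_hurwitzPoly hn hb, CompletedCycles.hodgeConstant]
  have h := CompletedCycles.neg_one_pow_mul_coeff_invSinhcSeries g
  -- The integer division is exact for odd `n`; for `n = 1` it yields `-1`.
  have hpow : (2 : ℚ) ^ (3 * (g : ℤ) + ((n : ℤ) - 3) / 2) =
      2 ^ (g + (n - 1) / 2) * (2 : ℚ) ^ (2 * (g : ℤ) - 1) := by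
    rw [← zpow_natCast, ← zpow_add₀ two_ne_zero]
    congr 1
    obtain ⟨m, rfl⟩ := hn
    push_cast
    omega
  rw [hpow, one_div_pow]
  have hz : (2 : ℚ) ^ (2 * (g : ℤ) - 1) ≠ 0 := zpow_ne_zero _ two_ne_zero
  have hf : ((2 * g).factorial : ℚ) ≠ 0 := by exact_mod_cast (2 * g).factorial_ne_zero
  have hs : ((g + (n - 1) / 2).factorial : ℚ) ≠ 0 := by
    exact_mod_cast (g + (n - 1) / 2).factorial_ne_zero
  rw [eq_div_iff (mul_ne_zero hf hz)] at h
  field_simp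
  linear_combination (Nat.multinomial Finset.univ b : ℚ) * h
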